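/- Let $\Bbbk$ be an algebraically closed field of characteristic zero. For $t\in\Bbbk$ let $X_t\subset\mathbb{P}^5$ be the closed subscheme given, in homogeneous coordinates $x_1,\dots,x_6$, by the equations $$x_1+x_2+x_3+x_4+x_5+x_6=0,\qquad (x_1^4+\dots+x_6^4)-t\,(x_1^2+\dots+x_6^2)^2=0,$$ and let $\mathcal{X}_\infty\subset\mathbb{P}(2,1^6)$ be the closed subscheme of the weighted projective space with coordinates $x_0$ (of weight $2$) and $x_1,\dots,x_6$ (of weight $1$) given by the equations $$x_1+\dots+x_6=0,\qquad x_0^2=(x_1^4+\dots+x_6^4)-\tfrac14(x_1^2+\dots+x_6^2)^2,\qquad x_1^2+\dots+x_6^2=0.$$ Then $X_t$ is unirational for every $t\in\Bbbk$, and $\mathcal{X}_\infty$ is unirational. Here a scheme $X$ over $\Bbbk$ is called unirational if it is integral and, for some $n\ge 0$, there is a dominant rational map $\mathbb{A}^n\dashrightarrow X$ over $\Bbbk$. -/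

import Mathlib

universe u

open CategoryTheory AlgebraicGeometry MvPolynomial

noncomputable section

/-! ### Closed subschemes of (weighted) projective spaces -/

namespace GradedQuotient

variable {k A : Type u} [Field k] [CommRing A] [Algebra k A]
variable (𝒜 : ℕ → Submodule k A) [GradedAlgebra 𝒜] (I : HomogeneousIdeal 𝒜)

/-- The grading of `A ⧸ I`, for a homogeneous ideal `I` of the graded `k`-algebra `A`: the piece of
degree `n` is the image of the piece of degree `n` of `A`. -/
def grading (n : ℕ) : Submodule k (A ⧸ I.toIdeal) :=
  (𝒜 n).map (Ideal.Quotient.mkₐ k I.toIdeal).toLinearMap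

/-- The projection `A → A ⧸ I` in degree `n`. -/
def pieceMap (n : ℕ) : 𝒜 n →+ grading 𝒜 I n where
  toFun a := ⟨Ideal.Quotient.mk I.toIdeal a, a, a.2, rfl⟩
  map_zero' := Subtype.ext (by simp)
  map_add' a b := Subtype.ext (by simp)

theorem pieceMap_surjective (n : ℕ) : Function.Surjective (pieceMap 𝒜 I n) := by
  rintro ⟨_, a, ha, rfl⟩
  exact ⟨⟨a, ha⟩, rfl⟩

/-- The decomposition of a class in `A ⧸ I` into the classes of the homogeneous components. -/
def decomposeHom : A ⧸ I.toIdeal →+ DirectSum ℕ fun n => grading 𝒜 I n :=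
  QuotientAddGroup.lift I.toIdeal.toAddSubgroup
    ((DirectSum.map (pieceMap 𝒜 I)).comp (DirectSum.decomposeAddEquiv 𝒜).toAddMonoidHom) (by
      intro a ha
      refine DFinsupp.ext fun n => Subtype.ext ?_
      exact Ideal.Quotient.eq_zero_iff_mem.mpr (I.isHomogeneous n ha))

theorem decomposeHom_mk (a : A) : decomposeHom 𝒜 I (Ideal.Quotient.mk I.toIdeal a) =
    DirectSum.map (pieceMap 𝒜 I) (DirectSum.decompose 𝒜 a) := rfl

instance : SetLike.GradedMonoid (grading 𝒜 I) where
  one_mem := ⟨1, SetLike.GradedOne.one_mem, map_one (Ideal.Quotient.mk I.toIdeal)⟩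
  mul_mem := by
    rintro i j _ _ ⟨a, ha, rfl⟩ ⟨b, hb, rfl⟩
    exact ⟨a * b, SetLike.GradedMul.mul_mem ha hb, map_mul (Ideal.Quotient.mk I.toIdeal) a b⟩

instance : DirectSum.Decomposition (grading 𝒜 I) where
  decompose' := decomposeHom 𝒜 I
  left_inv := by
    intro x
    obtain ⟨a, rfl⟩ := Ideal.Quotient.mk_surjective x
    rw [decomposeHom_mk]
    induction a using DirectSum.Decomposition.inductionOn 𝒜 with
    | zero => simp
    | homogeneous a => simp [pieceMap]
    | add a b ha hb => simp only [DirectSum.decompose_add, map_add, ha, hb]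
  right_inv := by
    intro x
    induction x using DirectSum.induction_on with
    | zero => simp
    | of n y =>
      obtain ⟨a, rfl⟩ := pieceMap_surjective 𝒜 I n y
      rw [DirectSum.coeAddMonoidHom_of]
      change decomposeHom 𝒜 I (Ideal.Quotient.mk I.toIdeal a) = _
      rw [decomposeHom_mk, DirectSum.decompose_coe, DirectSum.map_of]
    | add x y hx hy => simp only [map_add, hx, hy]

instance : GradedAlgebra (grading 𝒜 I) where

/-- The closed subscheme `Proj (A ⧸ I)` of `Proj A`. -/
abbrev scheme : Scheme.{u} := Proj (grading 𝒜 I)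

/-- The structure morphism `Proj (A ⧸ I) ⟶ Spec k`. -/
def toSpec : scheme 𝒜 I ⟶ Spec (.of k) :=
  Proj.toSpecZero (grading 𝒜 I) ≫
    Spec.map (CommRingCat.ofHom (algebraMap k (grading 𝒜 I 0)))

end GradedQuotient

/-! ### The quartics and the threefold -/

instance (k : Type u) [Field k] : GradedAlgebra (homogeneousSubmodule (Fin 6) k) :=
  gradedAlgebra

theorem isHomogeneous_psum_six (k : Type u) [Field k] (d : ℕ) :
    (psum (Fin 6) k d).IsHomogeneous d :=
  IsHomogeneous.sum _ _ _ fun i _ => by simpa using (isHomogeneous_X k i).pow d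

/-- The homogeneous ideal of `k[x₁, …, x₆]` generated by `x₁ + ⋯ + x₆` and
`(x₁⁴ + ⋯ + x₆⁴) - t (x₁² + ⋯ + x₆²)²`. (`psum σ k d` is the sum of `X i ^ d` over `i : σ`.) -/
def quarticIdeal {k : Type u} [Field k] (t : k) :
    HomogeneousIdeal (homogeneousSubmodule (Fin 6) k) where
  toSubmodule := Ideal.span
    {psum (Fin 6) k 1, psum (Fin 6) k 4 - C t * psum (Fin 6) k 2 ^ 2}
  is_homogeneous' := by
    refine Ideal.homogeneous_span _ _ ?_
    rintro p (rfl | rfl)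
    · exact ⟨1, isHomogeneous_psum_six k 1⟩
    · exact ⟨4, (isHomogeneous_psum_six k 4).sub (by
        simpa using (isHomogeneous_C _ t).mul ((isHomogeneous_psum_six k 2).pow 2))⟩

/-- The `𝔖₆`-invariant quartic `X_t`, as a subscheme of the projective space with coordinates
`x₁, …, x₆`. -/
abbrev quarticThreefold {k : Type u} [Field k] (t : k) : Scheme.{u} :=
  GradedQuotient.scheme (homogeneousSubmodule (Fin 6) k) (quarticIdeal t)

/-- The structure morphism of `X_t`. -/
abbrev quarticThreefoldToSpec {k : Type u} [Field k] (t : k) :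
    quarticThreefold t ⟶ Spec (.of k) :=
  GradedQuotient.toSpec (homogeneousSubmodule (Fin 6) k) (quarticIdeal t)

/-- The weights of the coordinates `x₀, x₁, …, x₆` of `ℙ(2, 1⁶)`. -/
def cobleWeight : Fin 7 → ℕ := ![2, 1, 1, 1, 1, 1, 1]

instance (k : Type u) [Field k] : GradedAlgebra (weightedHomogeneousSubmodule k cobleWeight) :=
  weightedGradedAlgebra k cobleWeight

/-- The power sum `x₁ᵈ + ⋯ + x₆ᵈ` as a polynomial in `x₀, x₁, …, x₆`. -/
def coblePsum (k : Type u) [Field k] (d : ℕ) : MvPolynomial (Fin 7) k :=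
  ∑ i : Fin 6, X i.succ ^ d

theorem isWeightedHomogeneous_coblePsum (k : Type u) [Field k] (d : ℕ) :
    IsWeightedHomogeneous cobleWeight (coblePsum k d) d := by
  refine IsWeightedHomogeneous.sum _ _ _ fun i _ => ?_
  have h : cobleWeight i.succ = 1 := by fin_cases i <;> rfl
  simpa [h] using (isWeightedHomogeneous_X k cobleWeight i.succ).pow d

/-- The weighted homogeneous ideal of `k[x₀, x₁, …, x₆]` generated by the equations
`x₁ + ⋯ + x₆ = 0` and `x₀² = (x₁⁴ + ⋯ + x₆⁴) - (1/4) (x₁² + ⋯ + x₆²)²` of the Coble fourfold and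
by the equation `x₁² + ⋯ + x₆² = 0`. -/
def threefoldInftyIdeal (k : Type u) [Field k] :
    HomogeneousIdeal (weightedHomogeneousSubmodule k cobleWeight) where
  toSubmodule := Ideal.span
    {coblePsum k 1,
      X 0 ^ 2 - (coblePsum k 4 - C (1 / 4) * coblePsum k 2 ^ 2),
      coblePsum k 2}
  is_homogeneous' := by
    refine Ideal.homogeneous_span _ _ ?_
    rintro p (rfl | rfl | rfl)
    · exact ⟨1, isWeightedHomogeneous_coblePsum k 1⟩
    · refine ⟨4, Submodule.sub_mem _ ?_ (Submodule.sub_mem _ ?_ ?_)⟩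
      · exact (isWeightedHomogeneous_X k cobleWeight 0).pow 2
      · exact isWeightedHomogeneous_coblePsum k 4
      · simpa using (isWeightedHomogeneous_C cobleWeight (1 / 4 : k)).mul
          ((isWeightedHomogeneous_coblePsum k 2).pow 2)
    · exact ⟨2, isWeightedHomogeneous_coblePsum k 2⟩

/-- The threefold `𝒳_∞`: the divisor `x₁² + ⋯ + x₆² = 0` in the Coble fourfold, as a subscheme of
the weighted projective space `ℙ(2, 1⁶)`. -/
abbrev threefoldInfty (k : Type u) [Field k] : Scheme.{u} :=
  GradedQuotient.scheme (weightedHomogeneousSubmodule k cobleWeight) (threefoldInftyIdeal k)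

/-- The structure morphism of `𝒳_∞`. -/
abbrev threefoldInftyToSpec (k : Type u) [Field k] : threefoldInfty k ⟶ Spec (.of k) :=
  GradedQuotient.toSpec (weightedHomogeneousSubmodule k cobleWeight) (threefoldInftyIdeal k)

/-! ### Unirationality -/

/-- A scheme `X` over a field `k`, with structure morphism `sX`, is unirational if it is integral
and there is a dominant rational map over `k` from an affine space of finite dimension to `X`
(equivalently, from a projective space, as these are birational). -/
structure IsUnirational {k : Type u} [Field k] {X : Scheme.{u}} (sX : X ⟶ Spec (.of k)) :
    Prop where
  isIntegral : IsIntegral X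
  exists_dominant : ∃ (n : Type u) (_ : Finite n) (f : 𝔸(n; Spec (.of k)) ⤏ X),
    f.IsDominant ∧ f.compHom sX = (𝔸(n; Spec (.of k)) ↘ Spec (.of k)).toRationalMap

end

/-!
The double cover `4 x₀² = 4 ∑ xᵢ⁴ - (∑ xᵢ²)²` of the hyperplane `∑ xᵢ = 0` is the Coble fourfold. It
is parametrized by pairs `(a, b)` of points of the plane (`coords`, `weightTwo`,
`four_mul_weightTwo_sq`), and a general point of it comes from such a pair (`exists_sndPoint`). All
the threefolds in question are divisors `κ x₀ + ρ ∑ xᵢ² = 0` of the Coble fourfold: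
substituting `x₀ = s ∑ xᵢ²` in its equation gives the quartic `X_t` with `t = 1 / 4 + s²`, and
`κ = 0` gives `𝒳_∞`.

On pairs of points the equation of such a divisor is quadratic in `b` (`conic`,
`weightTwo_add_sum_sq`), so the divisor is dominated by a bundle of conics over the plane of the
points `a`. A conic with a given point is parametrized by the lines through that point
(`secondPoint`), and it therefore suffices to find a rational surface over the plane on which the
conic has a tautological point. For `ρ = 0` all the conics contain a coordinate point. For `ρ ≠ 0`,
the line `b₃ = 0` cuts out two points of each conic, and these form a surface birational to a
quadric in `ℙ³` (`conic_quadricPoint`, `exists_tropeForm`). The parametrization of the quadric needs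
`κ ≠ 2ρ`, which for the quartics is achieved by the choice of the sign of `s`.

A homomorphism from the homogeneous coordinate ring to a polynomial ring with kernel `I` makes
`Proj (A ⧸ I)` integral and gives a dominant rational map (`isUnirational_of_ker_eq`). The kernel of
the homomorphism given by the parametrization is computed at the generic point
(`ker_eq_of_comp_eq`): the generic point satisfies the nondegeneracy conditions, because some
special point does, and so it is a value of the parametrization. This needs that the ideals are
prime. In coordinates which are eigenvectors of two commuting 3-cycles, the quartics are the members
of the pencil spanned by the Burkhardt quartic and a double quadric. They are irreducible because
any two components of a hyperplane section have a coordinate point in common at which the quartic is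
smooth (`irreducible_pencil`). The coordinate ring of `𝒳_∞` is a tower of two quadratic extensions
of a polynomial ring (`exists_normalForm`, `eq_zero_of_add_eq_zero`).
-/

noncomputable section

/-! ### Unirationality of `Proj` from a parametrization of the affine cone -/

namespace AlgebraicGeometry.Proj

variable {σ B : Type u} [CommRing B] [SetLike σ B] [AddSubgroupClass σ B]
variable (ℬ : ℕ → σ) [GradedRing ℬ]

theorem isReduced_of_isDomain [IsDomain B] : IsReduced (Proj ℬ) := by
  refine @IsReduced.of_openCover _ (Proj.affineOpenCover ℬ).openCover fun i => ?_
  change IsReduced (Spec (.of (HomogeneousLocalization.Away ℬ (i.2 : B))))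
  have hred : _root_.IsReduced (Localization.Away (i.2 : B)) :=
    isReduced_localizationPreserves (Submonoid.powers (i.2 : B)) _ inferInstance
  have : _root_.IsReduced (HomogeneousLocalization.Away ℬ (i.2 : B)) :=
    isReduced_of_injective
      (algebraMap (HomogeneousLocalization.Away ℬ (i.2 : B)) (Localization.Away (i.2 : B)))
      (HomogeneousLocalization.val_injective _)
  infer_instance

theorem irreducibleSpace_of_isDomain [IsDomain B] {d : ℕ} (hd : 0 < d) {f : B} (hf : f ∈ ℬ d)
    (hf0 : f ≠ 0) : IrreducibleSpace (Proj ℬ) := by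
  let η : ProjectiveSpectrum ℬ :=
    { asHomogeneousIdeal := ⊥
      isPrime := by
        rw [HomogeneousIdeal.toIdeal_bot]
        exact Ideal.isPrime_bot
      not_irrelevant_le := fun h => hf0 <| by
        have : f ∈ HomogeneousIdeal.irrelevant ℬ := by
          rw [HomogeneousIdeal.mem_irrelevant_iff, GradedRing.proj_apply,
            DirectSum.decompose_of_mem_ne ℬ hf hd.ne']
        exact (Ideal.mem_bot).mp (h this) }
  have hη : closure ({η} : Set (ProjectiveSpectrum ℬ)) = Set.univ :=
    Set.eq_univ_of_forall fun x =>
      (ProjectiveSpectrum.le_iff_mem_closure ℬ η x).mp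
        ((ProjectiveSpectrum.as_ideal_le_as_ideal ℬ η x).mp bot_le)
  have : IsPreirreducible (Set.univ : Set (ProjectiveSpectrum ℬ)) := by
    rw [← hη]
    exact isPreirreducible_singleton.closure
  exact { isPreirreducible_univ := this, toNonempty := ⟨η⟩ }

/-- `Proj` of a graded domain is integral, as soon as it is not empty. -/
theorem isIntegral_of_isDomain [IsDomain B] {d : ℕ} (hd : 0 < d) {f : B} (hf : f ∈ ℬ d)
    (hf0 : f ≠ 0) : IsIntegral (Proj ℬ) :=
  have := isReduced_of_isDomain ℬ
  have := irreducibleSpace_of_isDomain ℬ hd hf hf0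
  isIntegral_of_irreducibleSpace_of_isReduced _

end AlgebraicGeometry.Proj

/-- A morphism of affine schemes given by an injective ring homomorphism is dominant. -/
theorem isDominant_specMap_of_injective {R S : Type u} [CommRing R] [CommRing S] (g : R →+* S)
    (hg : Function.Injective g) : IsDominant (Spec.map (CommRingCat.ofHom g)) :=
  ⟨(PrimeSpectrum.denseRange_comap_iff_ker_le_nilRadical g).mpr
    (((RingHom.injective_iff_ker_eq_bot g).mp hg).trans_le bot_le)⟩

/-- If `j : U ⟶ Y` is a dominant open immersion, then a dominant morphism `h : U ⟶ X` defines a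
dominant rational map from `Y` to `X`, which is over a base `S` if `h` is. -/
theorem exists_dominant_rationalMap {U X Y S : Scheme.{u}} (j : U ⟶ Y) [IsOpenImmersion j]
    [IsDominant j] (h : U ⟶ X) [IsDominant h] (sX : X ⟶ S) (sY : Y ⟶ S)
    (hs : h ≫ sX = j ≫ sY) :
    ∃ f : Y ⤏ X, f.IsDominant ∧ f.compHom sX = sY.toRationalMap := by
  let p : Y.PartialMap X :=
    { domain := j.opensRange
      dense_domain := j.denseRange
      hom := j.isoOpensRange.inv ≫ h }
  refine ⟨p.toRationalMap, ?_, ?_⟩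
  · have : IsDominant p.hom := inferInstanceAs (IsDominant (j.isoOpensRange.inv ≫ h))
    infer_instance
  · rw [← Scheme.RationalMap.compHom_toRationalMap, Scheme.PartialMap.toRationalMap_eq_iff]
    refine ⟨j.opensRange, j.denseRange, le_rfl, le_top, ?_⟩
    change Y.homOfLE _ ≫ (j.isoOpensRange.inv ≫ h) ≫ sX = Y.homOfLE _ ≫ Y.topIso.hom ≫ sY
    rw [Category.assoc, hs]
    simp

variable {k A : Type u} [Field k] [CommRing A] [Algebra k A]
variable (𝒜 : ℕ → Submodule k A) [GradedAlgebra 𝒜] (I : HomogeneousIdeal 𝒜)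

/-- If a homomorphism `φ` from `A` to a polynomial ring has kernel `I`, then the closed subscheme
`Proj (A ⧸ I)` is unirational: `φ` is a dominant map from an affine space to the affine cone. It
need not respect the gradings, since it is only used on quotients of elements of equal degree. -/
theorem isUnirational_of_ker_eq {n : Type u} [Finite n] (φ : A →ₐ[k] MvPolynomial n k)
    (hφ : RingHom.ker φ = I.toIdeal) {d : ℕ} (hd : 0 < d) {f : A} (hf : f ∈ 𝒜 d)
    (hfI : f ∉ I.toIdeal) : IsUnirational (GradedQuotient.toSpec 𝒜 I) := by
  let ψ : (A ⧸ I.toIdeal) →ₐ[k] MvPolynomial n k :=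
    Ideal.Quotient.liftₐ I.toIdeal φ fun a ha => by rwa [← hφ] at ha
  have hψ : Function.Injective ψ := by
    rw [injective_iff_map_eq_zero]
    intro a ha
    obtain ⟨a, rfl⟩ := Ideal.Quotient.mk_surjective a
    rw [Ideal.Quotient.eq_zero_iff_mem, ← hφ]
    exact ha
  have : IsDomain (A ⧸ I.toIdeal) := hψ.isDomain ψ.toRingHom
  let g : A ⧸ I.toIdeal := Ideal.Quotient.mk I.toIdeal f
  have hg : g ∈ GradedQuotient.grading 𝒜 I d := ⟨f, hf, rfl⟩
  have hg0 : g ≠ 0 := fun h => hfI (Ideal.Quotient.eq_zero_iff_mem.mp h)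
  have hint : IsIntegral (GradedQuotient.scheme 𝒜 I) :=
    Proj.isIntegral_of_isDomain (GradedQuotient.grading 𝒜 I) hd hg hg0
  refine ⟨hint, n, inferInstance, ?_⟩
  have hψg : ψ g ≠ 0 := fun h => hg0 (hψ (h.trans (map_zero ψ).symm))
  -- The homomorphism `(A ⧸ I)_(g) → k[n]_{ψ g}` induced by `φ`.
  let loc : Localization.Away g →+* Localization.Away (ψ g) :=
    IsLocalization.map _ (T := Submonoid.powers (ψ g)) ψ.toRingHom
      (Submonoid.powers_le.mpr ⟨1, pow_one _⟩)
  have hloc : Function.Injective loc := by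
    refine IsLocalization.map_injective_of_injective' _ _ _ _ ?_ hψ
    rintro ⟨m, hm⟩
    exact hψg (eq_zero_of_pow_eq_zero hm)
  let away : HomogeneousLocalization.Away (GradedQuotient.grading 𝒜 I) g →+*
      Localization.Away (ψ g) :=
    loc.comp (algebraMap (HomogeneousLocalization.Away (GradedQuotient.grading 𝒜 I) g)
      (Localization.Away g))
  have haway : Function.Injective away := hloc.comp (HomogeneousLocalization.val_injective _)
  let j : Spec (.of (Localization.Away (ψ g))) ⟶ 𝔸(n; Spec (.of k)) :=
    Spec.map (CommRingCat.ofHom (algebraMap (MvPolynomial n k) (Localization.Away (ψ g)))) ≫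
      (AffineSpace.SpecIso n (.of k)).inv
  have hloc' : Function.Injective (algebraMap (MvPolynomial n k) (Localization.Away (ψ g))) :=
    IsLocalization.injective _ (powers_le_nonZeroDivisors_of_noZeroDivisors hψg)
  have : IsOpenImmersion (Spec.map (CommRingCat.ofHom
      (algebraMap (MvPolynomial n k) (Localization.Away (ψ g))))) :=
    AlgebraicGeometry.IsOpenImmersion.of_isLocalization (ψ g)
  have := isDominant_specMap_of_injective _ hloc'
  have : IsDominant j := inferInstanceAs (IsDominant (_ ≫ _))
  have : IsOpenImmersion j := inferInstanceAs (IsOpenImmersion (_ ≫ _))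
  let h : Spec (.of (Localization.Away (ψ g))) ⟶ GradedQuotient.scheme 𝒜 I :=
    Spec.map (CommRingCat.ofHom away) ≫ Proj.awayι (GradedQuotient.grading 𝒜 I) g hg hd
  have := isDominant_specMap_of_injective _ haway
  have : Nontrivial (Localization.Away (ψ g)) := hloc'.nontrivial
  have : Nontrivial (HomogeneousLocalization.Away (GradedQuotient.grading 𝒜 I) g) :=
    away.domain_nontrivial
  have : IsDominant (Proj.awayι (GradedQuotient.grading 𝒜 I) g hg hd) := by
    refine ⟨IsOpen.dense (Scheme.Hom.isOpenEmbedding _).isOpen_range ?_⟩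
    exact Set.range_nonempty _
  have : IsDominant h := inferInstanceAs (IsDominant (_ ≫ _))
  refine exists_dominant_rationalMap j h _ _ ?_
  simp only [h, j, GradedQuotient.toSpec, Category.assoc, AffineSpace.SpecIso_inv_over,
    Proj.awayι_toSpecZero_assoc, ← Spec.map_comp, ← CommRingCat.ofHom_comp]
  congr 2
  ext c
  simp only [RingHom.comp_apply]
  change loc (algebraMap _ (Localization.Away g) (algebraMap k (A ⧸ I.toIdeal) c)) = _
  simp only [loc, IsLocalization.map_eq]
  congr 1
  exact ψ.commutes c

/-! ### Pairs of points of the plane and the Coble fourfold -/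

namespace CobleFourfold

section Definitions

variable {R : Type*} [CommRing R]

/-- The map from pairs of points `a`, `b` of the plane to the hyperplane `x₁ + ⋯ + x₆ = 0`. With
`U = (a₁b₂, a₂b₃, a₃b₁)` and `V = (a₂b₁, a₃b₂, a₁b₃)`, which satisfy `U₁U₂U₃ = V₁V₂V₃`, the
coordinates of the image are `3 Uᵢ + ∑ V - 2 ∑ U` and `3 Vᵢ + ∑ U - 2 ∑ V`. -/
def coords (a b : Fin 3 → R) : Fin 6 → R :=
  ![3 * (a 0 * b 1) + (a 1 * b 0 + a 2 * b 1 + a 0 * b 2) -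
      2 * (a 0 * b 1 + a 1 * b 2 + a 2 * b 0),
    3 * (a 1 * b 2) + (a 1 * b 0 + a 2 * b 1 + a 0 * b 2) -
      2 * (a 0 * b 1 + a 1 * b 2 + a 2 * b 0),
    3 * (a 2 * b 0) + (a 1 * b 0 + a 2 * b 1 + a 0 * b 2) -
      2 * (a 0 * b 1 + a 1 * b 2 + a 2 * b 0),
    3 * (a 1 * b 0) + (a 0 * b 1 + a 1 * b 2 + a 2 * b 0) -
      2 * (a 1 * b 0 + a 2 * b 1 + a 0 * b 2),
    3 * (a 2 * b 1) + (a 0 * b 1 + a 1 * b 2 + a 2 * b 0) -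
      2 * (a 1 * b 0 + a 2 * b 1 + a 0 * b 2),
    3 * (a 0 * b 2) + (a 0 * b 1 + a 1 * b 2 + a 2 * b 0) -
      2 * (a 1 * b 0 + a 2 * b 1 + a 0 * b 2)]

/-- The coordinate of weight two on the Coble fourfold, as a function on pairs of points of the
plane. It vanishes when `a`, `b`, the coordinate points and `(1, 1, 1)` lie on a conic. -/
def weightTwo (a b : Fin 3 → R) : R :=
  9 * (b 0 * b 1 * (a 2 * (a 0 - a 1)) + b 1 * b 2 * (a 0 * (a 1 - a 2)) +
    b 0 * b 2 * (a 1 * (a 2 - a 0)))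

/-- The coefficients of squares in `conic`. -/
def squareCoeff (ρ x y : R) : R :=
  4 * ρ * (x ^ 2 - x * y + y ^ 2)

/-- The coefficients of mixed products in `conic`. -/
def crossCoeff (κ ρ x y z : R) : R :=
  3 * κ * (x * (y - z)) + 2 * ρ * (y * x + z * x - 2 * (y * z) - 2 * x ^ 2)

/-- The pullback of the divisor `κ x₀ + ρ (x₁² + ⋯ + x₆²) = 0` of the Coble fourfold to pairs of
points of the plane, as a quadratic form in `b` with coefficients depending on `a`. -/
def conic (κ ρ : R) (a b : Fin 3 → R) : R :=
  squareCoeff ρ (a 1) (a 2) * b 0 ^ 2 + squareCoeff ρ (a 2) (a 0) * b 1 ^ 2 +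
  squareCoeff ρ (a 0) (a 1) * b 2 ^ 2 + crossCoeff κ ρ (a 0) (a 1) (a 2) * (b 1 * b 2) +
  crossCoeff κ ρ (a 1) (a 2) (a 0) * (b 0 * b 2) + crossCoeff κ ρ (a 2) (a 0) (a 1) * (b 0 * b 1)

/-- The symmetric bilinear form in `b` and `b'` with diagonal `2 * conic κ ρ a b`. -/
def conicPolar (κ ρ : R) (a b b' : Fin 3 → R) : R :=
  2 * squareCoeff ρ (a 1) (a 2) * (b 0 * b' 0) + 2 * squareCoeff ρ (a 2) (a 0) * (b 1 * b' 1) +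
  2 * squareCoeff ρ (a 0) (a 1) * (b 2 * b' 2) +
  crossCoeff κ ρ (a 0) (a 1) (a 2) * (b 1 * b' 2 + b 2 * b' 1) +
  crossCoeff κ ρ (a 1) (a 2) (a 0) * (b 0 * b' 2 + b 2 * b' 0) +
  crossCoeff κ ρ (a 2) (a 0) (a 1) * (b 0 * b' 1 + b 1 * b' 0)

/-- The half-discriminant `4ABC + DEF - AD² - BE² - CF²` of the ternary quadratic form
`A x² + B y² + C z² + D yz + E xz + F xy`. -/
def halfDisc (A B C D E F : R) : R :=
  4 * A * B * C + D * E * F - A * D ^ 2 - B * E ^ 2 - C * F ^ 2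

/-- The half-discriminant of the quadratic form `conic κ ρ a`. Its zeros are the points `a` with
a singular fibre of the conic bundle. -/
def conicDisc (κ ρ : R) (a : Fin 3 → R) : R :=
  halfDisc (squareCoeff ρ (a 1) (a 2)) (squareCoeff ρ (a 2) (a 0)) (squareCoeff ρ (a 0) (a 1))
    (crossCoeff κ ρ (a 0) (a 1) (a 2)) (crossCoeff κ ρ (a 1) (a 2) (a 0))
    (crossCoeff κ ρ (a 2) (a 0) (a 1))

/-- The second point of intersection of the conic `conic κ ρ a` with the line that joins its point
`b` to `b'`. -/
def secondPoint (κ ρ : R) (a b b' : Fin 3 → R) : Fin 3 → R :=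
  conic κ ρ a b' • b - conicPolar κ ρ a b b' • b'

end Definitions

section Identities

variable {R : Type*} [CommRing R]

theorem sum_coords (a b : Fin 3 → R) : ∑ i, coords a b i = 0 := by
  simp [Fin.sum_univ_six, coords]
  ring

theorem weightTwo_add_sum_sq (κ ρ : R) (a b : Fin 3 → R) :
    κ * weightTwo a b + ρ * ∑ i, coords a b i ^ 2 = 3 * conic κ ρ a b := by
  simp [Fin.sum_univ_six, coords, weightTwo, conic, squareCoeff, crossCoeff]
  ring

theorem four_mul_weightTwo_sq (a b : Fin 3 → R) :
    4 * weightTwo a b ^ 2 = 4 * ∑ i, coords a b i ^ 4 - (∑ i, coords a b i ^ 2) ^ 2 := by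
  simp [Fin.sum_univ_six, coords, weightTwo]
  ring

theorem conic_add (κ ρ : R) (a b b' : Fin 3 → R) :
    conic κ ρ a (b + b') = conic κ ρ a b + conic κ ρ a b' + conicPolar κ ρ a b b' := by
  simp only [conic, conicPolar, Pi.add_apply]
  ring

theorem conic_smul_left (κ ρ c : R) (a b : Fin 3 → R) :
    conic κ ρ (c • a) b = c ^ 2 * conic κ ρ a b := by
  simp only [conic, squareCoeff, crossCoeff, Pi.smul_apply, smul_eq_mul]
  ring

theorem conic_smul_right (κ ρ c : R) (a b : Fin 3 → R) :
    conic κ ρ a (c • b) = c ^ 2 * conic κ ρ a b := by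
  simp only [conic, squareCoeff, crossCoeff, Pi.smul_apply, smul_eq_mul]
  ring

theorem conicPolar_smul (κ ρ c d : R) (a b b' : Fin 3 → R) :
    conicPolar κ ρ (c • a) (d • b) b' = c ^ 2 * d * conicPolar κ ρ a b b' := by
  simp only [conicPolar, squareCoeff, crossCoeff, Pi.smul_apply, smul_eq_mul]
  ring

theorem coords_smul (c d : R) (a b : Fin 3 → R) :
    coords (c • a) (d • b) = (c * d) • coords a b := by
  ext i
  fin_cases i <;> simp [coords] <;> ring

theorem weightTwo_smul (c d : R) (a b : Fin 3 → R) :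
    weightTwo (c • a) (d • b) = (c * d) ^ 2 * weightTwo a b := by
  simp [weightTwo]
  ring

theorem conic_secondPoint (κ ρ : R) (a b b' : Fin 3 → R) (hb : conic κ ρ a b = 0) :
    conic κ ρ a (secondPoint κ ρ a b b') = 0 := by
  have h : conicPolar κ ρ a (conic κ ρ a b' • b) (-conicPolar κ ρ a b b' • b') =
      -(conic κ ρ a b' * conicPolar κ ρ a b b' ^ 2) := by
    generalize hc : conic κ ρ a b' = c
    generalize hd : conicPolar κ ρ a b b' = d
    rw [show -(c * d ^ 2) = -(c * d * d) by ring]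
    nth_rewrite 3 [← hd]
    simp only [conicPolar, squareCoeff, crossCoeff, Pi.smul_apply, smul_eq_mul]
    ring
  rw [secondPoint, sub_eq_add_neg, ← neg_smul, conic_add, h, conic_smul_right, conic_smul_right,
    hb]
  ring

/-- An isotropic plane of a ternary quadratic form forces its discriminant to vanish; here the plane
is spanned by `(p, q, 0)` and `(x, y, z)`, and `z` times a coordinate of the first vector is its
minor. -/
theorem halfDisc_mul_sq_eq_zero {A B C D E F p q x y z : R}
    (h₁ : A * p ^ 2 + B * q ^ 2 + F * (p * q) = 0)
    (h₂ : 2 * A * (p * x) + 2 * B * (q * y) + D * (q * z) + E * (p * z) +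
      F * (p * y + q * x) = 0)
    (h₃ : A * x ^ 2 + B * y ^ 2 + C * z ^ 2 + D * (y * z) + E * (x * z) + F * (x * y) = 0) :
    2 * halfDisc A B C D E F * (q * z) ^ 2 = 0 ∧ 2 * halfDisc A B C D E F * (p * z) ^ 2 = 0 := by
  constructor
  · have key : 2 * halfDisc A B C D E F * (q * z) ^ 2 =
        (2 * (A * p ^ 2 + B * q ^ 2 + F * (p * q))) *
          ((2 * (A * x ^ 2 + B * y ^ 2 + C * z ^ 2 + D * (y * z) + E * (x * z) + F * (x * y))) *
            (2 * A) - (2 * A * x + F * y + E * z) ^ 2) -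
        (2 * A * (p * x) + 2 * B * (q * y) + D * (q * z) + E * (p * z) + F * (p * y + q * x)) *
          ((2 * A * (p * x) + 2 * B * (q * y) + D * (q * z) + E * (p * z) +
            F * (p * y + q * x)) * (2 * A) -
            2 * (2 * A * x + F * y + E * z) * (2 * A * p + F * q)) -
        (2 * A * p + F * q) ^ 2 *
          (2 * (A * x ^ 2 + B * y ^ 2 + C * z ^ 2 + D * (y * z) + E * (x * z) + F * (x * y))) := by
      simp only [halfDisc]
      ring
    rw [key, h₁, h₂, h₃]
    ring
  · have key : 2 * halfDisc A B C D E F * (p * z) ^ 2 =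
        (2 * (A * p ^ 2 + B * q ^ 2 + F * (p * q))) *
          ((2 * (A * x ^ 2 + B * y ^ 2 + C * z ^ 2 + D * (y * z) + E * (x * z) + F * (x * y))) *
            (2 * B) - (F * x + 2 * B * y + D * z) ^ 2) -
        (2 * A * (p * x) + 2 * B * (q * y) + D * (q * z) + E * (p * z) + F * (p * y + q * x)) *
          ((2 * A * (p * x) + 2 * B * (q * y) + D * (q * z) + E * (p * z) +
            F * (p * y + q * x)) * (2 * B) -
            2 * (F * x + 2 * B * y + D * z) * (2 * B * q + F * p)) -
        (2 * B * q + F * p) ^ 2 *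
          (2 * (A * x ^ 2 + B * y ^ 2 + C * z ^ 2 + D * (y * z) + E * (x * z) + F * (x * y))) := by
      simp only [halfDisc]
      ring
    rw [key, h₁, h₂, h₃]
    ring

end Identities

/-- On a smooth conic the point `b` with `b 2 = 0` and the point `b'` with `b' 2 ≠ 0` are not
orthogonal, since the conic contains no line. -/
theorem conicPolar_ne_zero {K : Type*} [Field K] [CharZero K] {κ ρ : K} {a b b' : Fin 3 → K}
    (hd : conicDisc κ ρ a ≠ 0) (hb : conic κ ρ a b = 0) (hb' : conic κ ρ a b' = 0)
    (hb0 : b ≠ 0) (hb2 : b 2 = 0) (hb2' : b' 2 ≠ 0) : conicPolar κ ρ a b b' ≠ 0 := by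
  intro h
  obtain ⟨h₁, h₂⟩ := halfDisc_mul_sq_eq_zero (p := b 0) (q := b 1) (x := b' 0) (y := b' 1)
    (z := b' 2)
    (A := squareCoeff ρ (a 1) (a 2)) (B := squareCoeff ρ (a 2) (a 0))
    (C := squareCoeff ρ (a 0) (a 1)) (D := crossCoeff κ ρ (a 0) (a 1) (a 2))
    (E := crossCoeff κ ρ (a 1) (a 2) (a 0)) (F := crossCoeff κ ρ (a 2) (a 0) (a 1))
    (by rw [← hb, conic, hb2]; ring) (by rw [← h, conicPolar, hb2]; ring)
    (by rw [← hb', conic])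
  rw [mul_assoc] at h₁ h₂
  have h₁ : b 1 = 0 := by
    simpa [hb2'] using (mul_eq_zero.mp ((mul_eq_zero.mp h₁).resolve_left two_ne_zero)).resolve_left
      hd
  have h₂ : b 0 = 0 := by
    simpa [hb2'] using (mul_eq_zero.mp ((mul_eq_zero.mp h₂).resolve_left two_ne_zero)).resolve_left
      hd
  refine hb0 (funext fun i => ?_)
  fin_cases i
  exacts [h₂, h₁, hb2]

end CobleFourfold

/-! ### Recovering a pair of points from a point of the Coble fourfold -/

namespace CobleFourfold

section Definitions

variable {R : Type*} [CommRing R]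

/-- The linear form of a hyperplane that is tangent to the Igusa quartic along a quadric. -/
def trope (x : Fin 6 → R) : R := x 0 + x 1 + x 2

/-- With `u = (x₁, x₂, x₃) - ℓ` and `v = (x₄, x₅, x₆)`, where `ℓ` is the trope, the polynomial
`∏ (uᵢ + m) - ∏ (vᵢ + m)` is quadratic in `m` with leading coefficient `-ℓ`, and this is its linear
coefficient. Its discriminant is `∑ xᵢ⁴ - (∑ xᵢ²)² / 4`. -/
def linearCoeff (x : Fin 6 → R) : R :=
  (x 0 - trope x) * (x 1 - trope x) + (x 1 - trope x) * (x 2 - trope x) +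
    (x 0 - trope x) * (x 2 - trope x) - (x 3 * x 4 + x 4 * x 5 + x 3 * x 5)

/-- The multiples by `-2ℓ` of the `Uᵢ = uᵢ + m`, where `m` is the root of the quadratic polynomial
of `linearCoeff` that belongs to the square root `z` of the discriminant. -/
def liftU (x : Fin 6 → R) (z : R) : Fin 3 → R :=
  ![z - linearCoeff x - 2 * trope x * (x 0 - trope x),
    z - linearCoeff x - 2 * trope x * (x 1 - trope x),
    z - linearCoeff x - 2 * trope x * (x 2 - trope x)]

/-- The multiples by `-2ℓ` of the `Vᵢ = vᵢ + m`, where `m` is as for `liftU`. -/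
def liftV (x : Fin 6 → R) (z : R) : Fin 3 → R :=
  ![z - linearCoeff x - 2 * trope x * x 3,
    z - linearCoeff x - 2 * trope x * x 4,
    z - linearCoeff x - 2 * trope x * x 5]

/-- The first one of the two points of the plane that map to `(x, z)`. -/
def fstPoint (x : Fin 6 → R) (z : R) : Fin 3 → R :=
  ![liftU x z 0 * liftU x z 2, liftV x z 0 * liftV x z 1, liftV x z 1 * liftU x z 2]

end Definitions

theorem prod_liftU_eq_prod_liftV {R : Type*} [CommRing R] {x : Fin 6 → R} {z : R}
    (hx : ∑ i, x i = 0) (hz : 4 * z ^ 2 = 4 * ∑ i, x i ^ 4 - (∑ i, x i ^ 2) ^ 2) :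
    2 * (liftU x z 0 * liftU x z 1 * liftU x z 2) =
      2 * (liftV x z 0 * liftV x z 1 * liftV x z 2) := by
  have h5 : x 5 = -(x 0 + x 1 + x 2 + x 3 + x 4) := by
    rw [Fin.sum_univ_six] at hx
    linear_combination hx
  simp only [Fin.sum_univ_six, h5] at hz
  simp only [liftU, liftV, linearCoeff, trope, Matrix.cons_val, h5]
  linear_combination (x 0 + x 1 + x 2) ^ 2 * hz

/-- A point `(x, z)` of the Coble fourfold, off some hyperplanes and quadrics, is the image of a
pair of points of the plane. -/
theorem exists_sndPoint {K : Type*} [Field K] [CharZero K] {x : Fin 6 → K} {z : K}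
    (hx : ∑ i, x i = 0) (hz : 4 * z ^ 2 = 4 * ∑ i, x i ^ 4 - (∑ i, x i ^ 2) ^ 2)
    (hℓ : trope x ≠ 0) (hU₁ : liftU x z 1 ≠ 0) (hU₂ : liftU x z 2 ≠ 0) (hV₀ : liftV x z 0 ≠ 0)
    (hV₁ : liftV x z 1 ≠ 0) :
    ∃ b : Fin 3 → K, coords (fstPoint x z) b = x ∧ weightTwo (fstPoint x z) b = z ∧ b 2 ≠ 0 := by
  have h5 : x 5 = -(x 0 + x 1 + x 2 + x 3 + x 4) := by
    rw [Fin.sum_univ_six] at hx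
    linear_combination hx
  have hprod : liftU x z 0 * liftU x z 1 * liftU x z 2 =
      liftV x z 0 * liftV x z 1 * liftV x z 2 :=
    mul_left_cancel₀ two_ne_zero (prod_liftU_eq_prod_liftV hx hz)
  let c : K := -(6 * trope x)
  have hc : c ≠ 0 := neg_ne_zero.mpr (mul_ne_zero (by norm_num) hℓ)
  let b : Fin 3 → K := ![1 / (c * liftV x z 1), 1 / (c * liftU x z 2),
    liftU x z 1 / (c * (liftV x z 0 * liftV x z 1))]
  have h₁ : fstPoint x z 0 * b 1 = liftU x z 0 / c := by
    simp only [fstPoint, b, Matrix.cons_val]; field_simp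
  have h₂ : fstPoint x z 1 * b 2 = liftU x z 1 / c := by
    simp only [fstPoint, b, Matrix.cons_val]; field_simp
  have h₃ : fstPoint x z 2 * b 0 = liftU x z 2 / c := by
    simp only [fstPoint, b, Matrix.cons_val]; field_simp
  have h₄ : fstPoint x z 1 * b 0 = liftV x z 0 / c := by
    simp only [fstPoint, b, Matrix.cons_val]; field_simp
  have h₅ : fstPoint x z 2 * b 1 = liftV x z 1 / c := by
    simp only [fstPoint, b, Matrix.cons_val]; field_simp
  have h₆ : fstPoint x z 0 * b 2 = liftV x z 2 / c := by
    simp only [fstPoint, b, Matrix.cons_val]; field_simp; linear_combination hprod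
  refine ⟨b, ?_, ?_, ?_⟩
  · simp only [coords, h₁, h₂, h₃, h₄, h₅, h₆]
    ext i
    fin_cases i <;> simp only [c, liftU, liftV, Matrix.cons_val, Fin.reduceFinMk, Fin.zero_eta,
      Fin.mk_one, Fin.isValue] <;> field_simp <;> simp only [trope, h5] <;> ring
  · have : weightTwo (fstPoint x z) b = 9 * ((fstPoint x z 0 * b 1) * (fstPoint x z 1 * b 2) +
        (fstPoint x z 1 * b 2) * (fstPoint x z 2 * b 0) +
        (fstPoint x z 0 * b 1) * (fstPoint x z 2 * b 0) -
        ((fstPoint x z 1 * b 0) * (fstPoint x z 2 * b 1) +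
        (fstPoint x z 2 * b 1) * (fstPoint x z 0 * b 2) +
        (fstPoint x z 1 * b 0) * (fstPoint x z 0 * b 2))) := by
      simp only [weightTwo]
      ring
    rw [this, h₁, h₂, h₃, h₄, h₅, h₆]
    simp only [c, liftU, liftV, Matrix.cons_val]
    field_simp
    simp only [linearCoeff, trope, h5]
    ring
  · simp only [b, Matrix.cons_val]
    exact div_ne_zero hU₁ (mul_ne_zero hc (mul_ne_zero hV₀ hV₁))

/-! ### A rational surface that meets the fibres of the conic bundle -/

section Definitions

variable {R : Type*} [CommRing R]

/-- The pairs `(a, b)` with `b = (p, q, 0)` are mapped to a hyperplane, on which these are linear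
coordinates such that `∑ xᵢ²` and `x₀` are combinations of the products of the first two and of the
last two. Here `ω` is a primitive cube root of unity. -/
def tropeForm (ω : R) (a : Fin 3 → R) (p q : R) : Fin 4 → R :=
  ![(a 2 + ω * a 1) * p + (a 0 + ω ^ 2 * a 2) * q,
    (a 2 + ω ^ 2 * a 1) * p + (a 0 + ω * a 2) * q,
    (a 1 + ω ^ 2 * a 2) * p + (a 2 + ω * a 0) * q,
    (a 1 + ω * a 2) * p + (a 2 + ω ^ 2 * a 0) * q]

/-- The values `(a₁q, a₃p, a₂p, a₃q)`, up to a factor `3`, in terms of the values `m` of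
`tropeForm ω a p q`. -/
def tropeInv (ω : R) (m : Fin 4 → R) : Fin 4 → R :=
  ![m 0 + m 1 - ω * m 2 - ω ^ 2 * m 3, m 0 + m 1 - ω ^ 2 * m 2 - ω * m 3,
    m 2 + m 3 - ω * m 0 - ω ^ 2 * m 1, m 2 + m 3 - ω ^ 2 * m 0 - ω * m 1]

/-- A parametrization of the quadric surface `(κ + 2ρ) m₁ m₂ + (2ρ - κ) m₃ m₄ = 0`. -/
def quadricPoint (κ ρ : R) (m : Fin 3 → R) : Fin 4 → R :=
  ![(2 * ρ - κ) * m 0 * m 2, (2 * ρ - κ) * m 1 * m 2, (2 * ρ - κ) * m 2 ^ 2,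
    -(κ + 2 * ρ) * m 0 * m 1]

/-- The point `a` of the pair `(a, b)` with `b₃ = 0` that belongs to the values
`w = (a₁b₂, a₃b₁, a₂b₁, a₃b₂)`. -/
def tropeFst (w : Fin 4 → R) : Fin 3 → R := ![w 0 * w 1, w 2 * w 3, w 3 * w 1]

/-- The point `b` of the pair `(a, b)` with `b₃ = 0` that belongs to the values
`w = (a₁b₂, a₃b₁, a₂b₁, a₃b₂)`. -/
def tropeSnd (w : Fin 4 → R) : Fin 3 → R := ![w 1, w 3, 0]

/-- The resultant of two of the linear forms `tropeForm ω a p q` in `p` and `q`. -/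
def tropeRes (ω : R) (a : Fin 3 → R) (i j : Fin 4) : R :=
  tropeForm ω a 1 0 i * tropeForm ω a 0 1 j - tropeForm ω a 0 1 i * tropeForm ω a 1 0 j

end Definitions

section Identities

variable {R : Type*} [CommRing R] {ω : R}

theorem conic_tropeFst_tropeSnd (hω : ω ^ 2 + ω + 1 = 0) (κ ρ : R) (m : Fin 4 → R) :
    conic κ ρ (tropeFst (tropeInv ω m)) (tropeSnd (tropeInv ω m)) =
      9 * (tropeInv ω m 1 * tropeInv ω m 3) ^ 2 *
        ((κ + 2 * ρ) * (m 0 * m 1) + (2 * ρ - κ) * (m 2 * m 3)) := by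
  have h (w : Fin 4 → R) : conic κ ρ (tropeFst w) (tropeSnd w) = (w 1 * w 3) ^ 2 *
      (3 * κ * (w 0 * w 1 - w 2 * w 3) + ρ * (3 * (w 0 ^ 2 + w 1 ^ 2 + w 2 ^ 2 + w 3 ^ 2) +
        (w 0 + w 1) ^ 2 + (w 2 + w 3) ^ 2 - 4 * (w 0 + w 1) * (w 2 + w 3))) := by
    simp only [conic, squareCoeff, crossCoeff, tropeFst, tropeSnd, Matrix.cons_val]
    ring
  have hω2 : ω ^ 2 = -1 - ω := by linear_combination hω
  have h' (c d e : R) (hde : d = 9 * e) : c * d = 9 * c * e := by rw [hde]; ring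
  rw [h]
  refine h' _ _ _ ?_
  simp only [tropeInv, Matrix.cons_val, hω2]
  linear_combination (3 * κ * ((m 0 - m 1) ^ 2 - (m 2 - m 3) ^ 2) +
    6 * ρ * ((m 0 - m 1) ^ 2 + (m 2 - m 3) ^ 2)) * hω

theorem conic_eq_tropeForm (hω : ω ^ 2 + ω + 1 = 0) (κ ρ : R) (a : Fin 3 → R) (p q : R) :
    conic κ ρ a ![p, q, 0] =
      (κ + 2 * ρ) * (tropeForm ω a p q 0 * tropeForm ω a p q 1) +
      (2 * ρ - κ) * (tropeForm ω a p q 2 * tropeForm ω a p q 3) := by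
  have hω2 : ω ^ 2 = -1 - ω := by linear_combination hω
  simp only [conic, squareCoeff, crossCoeff, tropeForm, Matrix.cons_val, hω2]
  grind

theorem tropeInv_tropeForm (hω : ω ^ 2 + ω + 1 = 0) (a : Fin 3 → R) (p q : R) :
    tropeInv ω (tropeForm ω a p q) = (3 : R) • ![a 0 * q, a 2 * p, a 1 * p, a 2 * q] := by
  have hω2 : ω ^ 2 = -1 - ω := by linear_combination hω
  ext i
  fin_cases i <;> simp [tropeInv, tropeForm, hω2] <;> grind

theorem tropeInv_smul (c : R) (m : Fin 4 → R) : tropeInv ω (c • m) = c • tropeInv ω m := by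
  ext i
  fin_cases i <;> simp [tropeInv] <;> ring

theorem tropeForm_eq (a : Fin 3 → R) (p q : R) (i : Fin 4) :
    tropeForm ω a p q i = tropeForm ω a 1 0 i * p + tropeForm ω a 0 1 i * q := by
  fin_cases i <;> simp [tropeForm]

end Identities

/-- Over an algebraically closed field a general conic of the bundle meets the line `b₃ = 0` in a
point that belongs to the image of the parametrization `quadricPoint`. -/
theorem exists_tropeForm {K : Type*} [Field K] [IsAlgClosed K] [CharZero K] {ω κ ρ : K}
    (hω : ω ^ 2 + ω + 1 = 0) (hρ : ρ ≠ 0) {a : Fin 3 → K}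
    (h₂₀ : tropeRes ω a 2 0 ≠ 0) (h₂₁ : tropeRes ω a 2 1 ≠ 0) (h₂₃ : tropeRes ω a 2 3 ≠ 0)
    (hs₀ : a 1 ^ 2 - a 1 * a 2 + a 2 ^ 2 ≠ 0) (hs₁ : a 2 ^ 2 - a 2 * a 0 + a 0 ^ 2 ≠ 0) :
    ∃ p q : K, p ≠ 0 ∧ q ≠ 0 ∧ conic κ ρ a ![p, q, 0] = 0 ∧ tropeForm ω a p q 2 ≠ 0 := by
  have hs₀ : squareCoeff ρ (a 1) (a 2) ≠ 0 := mul_ne_zero (mul_ne_zero (by norm_num) hρ) hs₀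
  have hs₁ : squareCoeff ρ (a 2) (a 0) ≠ 0 := mul_ne_zero (mul_ne_zero (by norm_num) hρ) hs₁
  -- Two linear forms with nonzero resultant have no common zero other than zero.
  have hres {i : Fin 4} (hi : tropeRes ω a 2 i ≠ 0) {p q : K} (h2 : tropeForm ω a p q 2 = 0)
      (h : tropeForm ω a p q i = 0) : p = 0 ∧ q = 0 := by
    rw [tropeForm_eq] at h2 h
    constructor
    · refine (mul_eq_zero.mp ?_).resolve_left hi
      rw [tropeRes]
      linear_combination tropeForm ω a 0 1 i * h2 - tropeForm ω a 0 1 2 * h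
    · refine (mul_eq_zero.mp ?_).resolve_left hi
      rw [tropeRes]
      linear_combination tropeForm ω a 1 0 2 * h - tropeForm ω a 1 0 i * h2
  suffices H : ∃ p q : K, conic κ ρ a ![p, q, 0] = 0 ∧ tropeForm ω a p q 2 ≠ 0 by
    obtain ⟨p, q, h, h2⟩ := H
    have hpq : ¬ (p = 0 ∧ q = 0) := by
      rintro ⟨rfl, rfl⟩
      exact h2 (by rw [tropeForm_eq]; simp)
    refine ⟨p, q, ?_, ?_, h, h2⟩
    · rintro rfl
      exact hpq ⟨rfl, by simpa [conic, hs₁] using h⟩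
    · rintro rfl
      exact hpq ⟨by simpa [conic, hs₀] using h, rfl⟩
  by_cases hα : κ + 2 * ρ = 0
  · -- The conic meets the line where one of the last two linear forms vanishes.
    refine ⟨-tropeForm ω a 0 1 3, tropeForm ω a 1 0 3, ?_, ?_⟩
    · have h₃ : tropeForm ω a (-tropeForm ω a 0 1 3) (tropeForm ω a 1 0 3) 3 = 0 := by
        rw [tropeForm_eq]
        ring
      rw [conic_eq_tropeForm hω, hα, h₃]
      ring
    · rw [tropeForm_eq]
      intro h
      refine h₂₃ ?_
      rw [tropeRes]
      linear_combination -h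
  · obtain ⟨s, hs⟩ := IsAlgClosed.exists_pow_nat_eq
      (crossCoeff κ ρ (a 2) (a 0) (a 1) ^ 2 - 4 * squareCoeff ρ (a 1) (a 2) *
        squareCoeff ρ (a 2) (a 0)) (n := 2) two_pos
    have hc : conic κ ρ a ![s - crossCoeff κ ρ (a 2) (a 0) (a 1),
        2 * squareCoeff ρ (a 1) (a 2), 0] = 0 := by
      simp only [conic, Matrix.cons_val]
      linear_combination squareCoeff ρ (a 1) (a 2) * hs
    refine ⟨_, _, hc, fun h2 => ?_⟩
    have hq : 2 * squareCoeff ρ (a 1) (a 2) ≠ 0 := mul_ne_zero two_ne_zero hs₀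
    rw [conic_eq_tropeForm hω, h2] at hc
    simp only [zero_mul, mul_zero, add_zero, mul_eq_zero, hα, false_or] at hc
    rcases hc with h | h
    · exact hq (hres h₂₀ h2 h).2
    · exact hq (hres h₂₁ h2 h).2

end CobleFourfold

/-! ### Two parametrizations of the conic bundle -/

namespace CobleFourfold

theorem conic_quadricPoint {R : Type*} [CommRing R] {ω : R} (hω : ω ^ 2 + ω + 1 = 0) (κ ρ : R)
    (m : Fin 3 → R) :
    conic κ ρ (tropeFst (tropeInv ω (quadricPoint κ ρ m)))
      (tropeSnd (tropeInv ω (quadricPoint κ ρ m))) = 0 := by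
  rw [conic_tropeFst_tropeSnd hω]
  simp only [quadricPoint, Matrix.cons_val]
  ring

theorem conic_zero_right {R : Type*} [CommRing R] (κ : R) (a : Fin 3 → R) :
    conic κ 0 a ![1, 0, 0] = 0 := by
  simp [conic, squareCoeff]

section Generic

variable {K : Type*} [Field K] {κ ρ : K}

/-- Every point `b'` of the conic over `a` is proportional to the second point of intersection with
the line that joins it to the known point `b`. The scalar also absorbs rescalings of `a` and `b`. -/
theorem exists_secondPoint {a b b' : Fin 3 → K} (hb' : conic κ ρ a b' = 0)
    (hp : conicPolar κ ρ a b b' ≠ 0) {c d : K} (hc : c ≠ 0) (hd : d ≠ 0) :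
    ∃ s : K, coords (c • a) (s • secondPoint κ ρ (c • a) (d • b) b') = coords a b' ∧
      weightTwo (c • a) (s • secondPoint κ ρ (c • a) (d • b) b') = weightTwo a b' := by
  have h : secondPoint κ ρ (c • a) (d • b) b' = -(c ^ 2 * d * conicPolar κ ρ a b b') • b' := by
    rw [secondPoint, conic_smul_left, hb', conicPolar_smul]
    simp
  refine ⟨-(c ^ 3 * d * conicPolar κ ρ a b b')⁻¹, ?_⟩
  have h1 : c * (-(c ^ 3 * d * conicPolar κ ρ a b b')⁻¹ * -(c ^ 2 * d * conicPolar κ ρ a b b')) =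
      1 := by
    field_simp
  rw [h, smul_smul, coords_smul, weightTwo_smul, h1]
  simp

/-- The complement of the zeros of this function is a locus where `fstPoint` is defined, and where
`exists_tropeForm` can be applied to its value. -/
def goodLocus {R : Type*} [CommRing R] (ω : R) (x : Fin 6 → R) (z : R) : R :=
  trope x * (liftU x z 1 * liftU x z 2) * (liftV x z 0 * liftV x z 1) *
    (tropeRes ω (fstPoint x z) 2 0 * tropeRes ω (fstPoint x z) 2 1 *
      tropeRes ω (fstPoint x z) 2 3) *
    (fstPoint x z 1 ^ 2 - fstPoint x z 1 * fstPoint x z 2 + fstPoint x z 2 ^ 2) *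
    (fstPoint x z 2 ^ 2 - fstPoint x z 2 * fstPoint x z 0 + fstPoint x z 0 ^ 2)

variable [CharZero K]

theorem conic_eq_zero_of_coords_eq {x : Fin 6 → K} {z : K} (h : κ * z + ρ * ∑ i, x i ^ 2 = 0)
    {a b : Fin 3 → K} (hx : coords a b = x) (hz : weightTwo a b = z) : conic κ ρ a b = 0 := by
  rw [← hx, ← hz, weightTwo_add_sum_sq] at h
  exact (mul_eq_zero.mp h).resolve_left three_ne_zero

/-- A general point of the divisor `κ x₀ + ρ ∑ xᵢ² = 0` is a value of the parametrization of the
conic bundle that is given by its double section over the quadric surface of `quadricPoint`. -/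
theorem exists_eq_coords_of_quadricPoint [IsAlgClosed K] {ω : K} (hω : ω ^ 2 + ω + 1 = 0)
    (hρ : ρ ≠ 0) (hβ : 2 * ρ - κ ≠ 0) {x : Fin 6 → K} {z : K} (hx : ∑ i, x i = 0)
    (hz : 4 * z ^ 2 = 4 * ∑ i, x i ^ 4 - (∑ i, x i ^ 2) ^ 2) (h : κ * z + ρ * ∑ i, x i ^ 2 = 0)
    (hgood : goodLocus ω x z ≠ 0) (hdisc : conicDisc κ ρ (fstPoint x z) ≠ 0) :
    ∃ (m b : Fin 3 → K) (s : K),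
      coords (tropeFst (tropeInv ω (quadricPoint κ ρ m)))
        (s • secondPoint κ ρ (tropeFst (tropeInv ω (quadricPoint κ ρ m)))
          (tropeSnd (tropeInv ω (quadricPoint κ ρ m))) b) = x ∧
      weightTwo (tropeFst (tropeInv ω (quadricPoint κ ρ m)))
        (s • secondPoint κ ρ (tropeFst (tropeInv ω (quadricPoint κ ρ m)))
          (tropeSnd (tropeInv ω (quadricPoint κ ρ m))) b) = z := by
  simp only [goodLocus, mul_ne_zero_iff] at hgood
  obtain ⟨⟨⟨⟨⟨hℓ, hU₁, hU₂⟩, hV₀, hV₁⟩, ⟨h₂₀, h₂₁⟩, h₂₃⟩, hs₀⟩, hs₁⟩ := hgood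
  obtain ⟨b, hbx, hbz, hb2⟩ := exists_sndPoint hx hz hℓ hU₁ hU₂ hV₀ hV₁
  have ha2 : fstPoint x z 2 ≠ 0 := by simpa [fstPoint] using ⟨hV₁, hU₂⟩
  generalize fstPoint x z = a at *
  have hb := conic_eq_zero_of_coords_eq h hbx hbz
  obtain ⟨p, q, hp, hq, hpq, h2⟩ := exists_tropeForm hω hρ h₂₀ h₂₁ h₂₃ hs₀ hs₁
  have hpolar : conicPolar κ ρ a ![p, q, 0] b ≠ 0 :=
    conicPolar_ne_zero hdisc hpq hb (fun h => hp (congrFun h 0)) rfl hb2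
  let m : Fin 3 → K := ![tropeForm ω a p q 0, tropeForm ω a p q 1, tropeForm ω a p q 2]
  -- On the quadric the fourth coordinate is determined by the first three.
  have hm : quadricPoint κ ρ m = ((2 * ρ - κ) * tropeForm ω a p q 2) • tropeForm ω a p q := by
    have := conic_eq_tropeForm hω κ ρ a p q
    ext i
    fin_cases i <;> simp only [quadricPoint, m, Matrix.cons_val, Pi.smul_apply, smul_eq_mul,
      Fin.reduceFinMk, Fin.zero_eta, Fin.mk_one, Fin.isValue]
    · ring
    · ring
    · ring
    · linear_combination this - hpq
  have hw : tropeInv ω (quadricPoint κ ρ m) = (3 * ((2 * ρ - κ) * tropeForm ω a p q 2)) •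
      ![a 0 * q, a 2 * p, a 1 * p, a 2 * q] := by
    rw [hm, tropeInv_smul, tropeInv_tropeForm hω, smul_smul, mul_comm (3 : K)]
  have he : 3 * ((2 * ρ - κ) * tropeForm ω a p q 2) ≠ 0 :=
    mul_ne_zero three_ne_zero (mul_ne_zero hβ h2)
  generalize 3 * ((2 * ρ - κ) * tropeForm ω a p q 2) = e at hw he
  have hA : tropeFst (tropeInv ω (quadricPoint κ ρ m)) = (e ^ 2 * (a 2 * p * q)) • a := by
    rw [hw]
    ext i
    fin_cases i <;> simp [tropeFst] <;> ring
  have hB : tropeSnd (tropeInv ω (quadricPoint κ ρ m)) = (e * a 2) • ![p, q, 0] := by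
    rw [hw]
    ext i
    fin_cases i <;> simp [tropeSnd] <;> ring
  obtain ⟨s, hs⟩ := exists_secondPoint hb hpolar (c := e ^ 2 * (a 2 * p * q)) (d := e * a 2)
    (by simp [he, ha2, hp, hq]) (by simp [he, ha2])
  refine ⟨m, b, s, ?_⟩
  rw [hA, hB, hs.1, hs.2]
  exact ⟨hbx, hbz⟩

/-- On the divisor `x₀ = 0` all the conics pass through the coordinate points, which gives a
section of the conic bundle. -/
theorem exists_eq_coords_of_zero {ω : K} {x : Fin 6 → K} {z : K} (hx : ∑ i, x i = 0)
    (hz : 4 * z ^ 2 = 4 * ∑ i, x i ^ 4 - (∑ i, x i ^ 2) ^ 2) (h : κ * z = 0)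
    (hgood : goodLocus ω x z ≠ 0) (hdisc : conicDisc κ 0 (fstPoint x z) ≠ 0) :
    ∃ (a b : Fin 3 → K) (s : K),
      coords a (s • secondPoint κ 0 a ![1, 0, 0] b) = x ∧
      weightTwo a (s • secondPoint κ 0 a ![1, 0, 0] b) = z := by
  simp only [goodLocus, mul_ne_zero_iff] at hgood
  obtain ⟨⟨⟨⟨⟨hℓ, hU₁, hU₂⟩, hV₀, hV₁⟩, -⟩, -⟩, -⟩ := hgood
  obtain ⟨b, hbx, hbz, hb2⟩ := exists_sndPoint hx hz hℓ hU₁ hU₂ hV₀ hV₁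
  have hb := conic_eq_zero_of_coords_eq (ρ := 0) (by rw [h]; simp) hbx hbz
  have hpolar : conicPolar κ 0 (fstPoint x z) ![1, 0, 0] b ≠ 0 :=
    conicPolar_ne_zero hdisc (conic_zero_right _ _) hb (fun h => one_ne_zero (congrFun h 0)) rfl hb2
  obtain ⟨s, hs⟩ := exists_secondPoint hb hpolar (c := 1) (d := 1) one_ne_zero one_ne_zero
  rw [one_smul, one_smul] at hs
  exact ⟨_, b, s, hs.1.trans hbx, hs.2.trans hbz⟩

end Generic

/-! ### Compatibility with ring homomorphisms -/

section Map

variable {R S : Type*} [CommRing R] [CommRing S] (f : R →+* S)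

theorem map_coords (a b : Fin 3 → R) (i : Fin 6) :
    f (coords a b i) = coords (f ∘ a) (f ∘ b) i := by
  fin_cases i <;> simp [coords, map_ofNat f]

theorem map_weightTwo (a b : Fin 3 → R) : f (weightTwo a b) = weightTwo (f ∘ a) (f ∘ b) := by
  simp [weightTwo, map_ofNat f]

theorem map_conic (κ ρ : R) (a b : Fin 3 → R) :
    f (conic κ ρ a b) = conic (f κ) (f ρ) (f ∘ a) (f ∘ b) := by
  simp [conic, squareCoeff, crossCoeff, map_ofNat f]

theorem comp_secondPoint (κ ρ : R) (a b b' : Fin 3 → R) :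
    f ∘ secondPoint κ ρ a b b' = secondPoint (f κ) (f ρ) (f ∘ a) (f ∘ b) (f ∘ b') := by
  ext i
  simp [secondPoint, map_conic, conicPolar, squareCoeff, crossCoeff, map_ofNat f]

theorem comp_tropeFst (w : Fin 4 → R) : f ∘ tropeFst w = tropeFst (f ∘ w) := by
  ext i
  fin_cases i <;> simp [tropeFst]

theorem comp_tropeSnd (w : Fin 4 → R) : f ∘ tropeSnd w = tropeSnd (f ∘ w) := by
  ext i
  fin_cases i <;> simp [tropeSnd]

theorem comp_tropeInv (ω : R) (m : Fin 4 → R) : f ∘ tropeInv ω m = tropeInv (f ω) (f ∘ m) := by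
  ext i
  fin_cases i <;> simp [tropeInv]

theorem comp_quadricPoint (κ ρ : R) (m : Fin 3 → R) :
    f ∘ quadricPoint κ ρ m = quadricPoint (f κ) (f ρ) (f ∘ m) := by
  ext i
  fin_cases i <;> simp [quadricPoint, map_ofNat f]

theorem comp_fstPoint (x : Fin 6 → R) (z : R) : f ∘ fstPoint x z = fstPoint (f ∘ x) (f z) := by
  ext i
  fin_cases i <;> simp [fstPoint, liftU, liftV, linearCoeff, trope, map_ofNat f]

theorem map_conicDisc (κ ρ : R) (a : Fin 3 → R) :
    f (conicDisc κ ρ a) = conicDisc (f κ) (f ρ) (f ∘ a) := by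
  simp [conicDisc, halfDisc, squareCoeff, crossCoeff, map_ofNat f]

theorem map_tropeRes (ω : R) (a : Fin 3 → R) (i j : Fin 4) :
    f (tropeRes ω a i j) = tropeRes (f ω) (f ∘ a) i j := by
  have h (p q : R) (i : Fin 4) :
      f (tropeForm ω a p q i) = tropeForm (f ω) (f ∘ a) (f p) (f q) i := by
    fin_cases i <;> simp [tropeForm]
  simp [tropeRes, h]

theorem map_goodLocus (ω : R) (x : Fin 6 → R) (z : R) :
    f (goodLocus ω x z) = goodLocus (f ω) (f ∘ x) (f z) := by
  have h (i : Fin 3) : f (fstPoint x z i) = fstPoint (f ∘ x) (f z) i :=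
    congrFun (comp_fstPoint f x z) i
  simp [goodLocus, map_tropeRes, comp_fstPoint, h, liftU, liftV, linearCoeff, trope, map_ofNat f]

end Map

/-! ### Special points -/

section SpecialPoints

variable {K : Type*} [Field K]

/-- A point of the surface `∑ xᵢ = ∑ xᵢ² = ∑ xᵢ⁴ = 0`. -/
def basePoint (ω : K) : Fin 6 → K := ![1, -ω, 1 + ω, -1 - ω, ω, -1]

theorem sum_basePoint (ω : K) : ∑ i, basePoint ω i = 0 := by
  simp [Fin.sum_univ_six, basePoint]
  ring

theorem sum_basePoint_sq {ω : K} (hω : ω ^ 2 + ω + 1 = 0) : ∑ i, basePoint ω i ^ 2 = 0 := by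
  simp [Fin.sum_univ_six, basePoint]
  linear_combination 4 * hω

theorem sum_basePoint_pow_four {ω : K} (hω : ω ^ 2 + ω + 1 = 0) :
    ∑ i, basePoint ω i ^ 4 = 0 := by
  simp [Fin.sum_univ_six, basePoint]
  linear_combination 4 * (ω ^ 2 + ω + 1) * hω

theorem fstPoint_basePoint {ω : K} (hω : ω ^ 2 + ω + 1 = 0) :
    fstPoint (basePoint ω) 0 = ![0, 16, -16] := by
  ext i
  fin_cases i <;> simp [fstPoint, basePoint, liftU, liftV, linearCoeff, trope] <;> grind

theorem conicDisc_basePoint {ω : K} (hω : ω ^ 2 + ω + 1 = 0) (κ ρ : K) :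
    conicDisc κ ρ (fstPoint (basePoint ω) 0) =
      16 ^ 6 * 27 * 4 * (ρ * (2 * ρ - κ) * (κ + 2 * ρ)) := by
  rw [fstPoint_basePoint hω]
  simp only [conicDisc, halfDisc, squareCoeff, crossCoeff, Matrix.cons_val]
  ring

variable [CharZero K]

theorem goodLocus_basePoint {ω : K} (hω : ω ^ 2 + ω + 1 = 0) :
    goodLocus ω (basePoint ω) 0 ≠ 0 := by
  have hω2 : ω ^ 2 = -1 - ω := by linear_combination hω
  have h₀ : ω ≠ 0 := by rintro rfl; simp at hω
  have h₁ : ω + 1 ≠ 0 := fun h => by simp [show ω = -1 by linear_combination h] at hω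
  have h₂ : 1 + 2 * ω ≠ 0 := fun h => by
    have : (3 : K) = 0 := by linear_combination 4 * hω - (1 + 2 * ω) * h
    norm_num at this
  have hℓ : trope (basePoint ω) = 2 := by simp [trope, basePoint]; ring
  have hU₁ : liftU (basePoint ω) 0 1 = 4 * (ω + 1) := by
    simp [liftU, linearCoeff, trope, basePoint]; ring
  have hU₂ : liftU (basePoint ω) 0 2 = -4 * ω := by
    simp [liftU, linearCoeff, trope, basePoint]; ring
  have hV₀ : liftV (basePoint ω) 0 0 = 4 * ω := by
    simp [liftV, linearCoeff, trope, basePoint]; ring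
  have hV₁ : liftV (basePoint ω) 0 1 = -4 * (ω + 1) := by
    simp [liftV, linearCoeff, trope, basePoint]; ring
  have h₂₀ : tropeRes ω ![0, 16, -16] 2 0 = 256 * (3 * ω) := by
    simp [tropeRes, tropeForm, hω2]; grind
  have h₂₁ : tropeRes ω ![0, 16, -16] 2 1 = -256 * (1 + 2 * ω) := by
    simp [tropeRes, tropeForm, hω2]; grind
  have h₂₃ : tropeRes ω ![0, 16, -16] 2 3 = -256 * (1 + 2 * ω) := by
    simp [tropeRes, tropeForm, hω2]; grind
  rw [goodLocus, fstPoint_basePoint hω, hℓ, hU₁, hU₂, hV₀, hV₁, h₂₀, h₂₁, h₂₃]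
  simp [h₀, h₁, h₂]
  norm_num

theorem conicDisc_one_zero_ne_zero :
    conicDisc 1 0 (fstPoint (![3, -5, -2, 3, 3, -2] : Fin 6 → K) 0) ≠ 0 := by
  simp [conicDisc, halfDisc, squareCoeff, crossCoeff, fstPoint, liftU, liftV, linearCoeff, trope]
  norm_num

theorem conicDisc_one_neg_half_ne_zero :
    conicDisc 1 (-(1 / 2)) (fstPoint (![0, -2, 1, 0, 0, 1] : Fin 6 → K) 3) ≠ 0 := by
  simp [conicDisc, halfDisc, squareCoeff, crossCoeff, fstPoint, liftU, liftV, linearCoeff, trope]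
  norm_num

end SpecialPoints

end CobleFourfold

/-! ### Irreducibility of the quartics -/

namespace CobleFourfold

variable {k : Type u} [Field k]

variable (k) in
/-- The Burkhardt quartic in the variables `n, m₁, …, m₄`. -/
def burkhardt : MvPolynomial (Fin 5) k :=
  -X 0 ^ 4 + X 0 * (X 1 ^ 3 + X 2 ^ 3 - X 3 ^ 3 - X 4 ^ 3) - C 3 * (X 1 * X 2 * X 3 * X 4)

variable (k) in
/-- The quadric `n² + m₁m₂ + m₃m₄`. -/
def invQuadric : MvPolynomial (Fin 5) k := X 0 ^ 2 + X 1 * X 2 + X 3 * X 4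

/-- The pencil spanned by the Burkhardt quartic and the double quadric. -/
def pencil (c : k) : MvPolynomial (Fin 5) k := burkhardt k + C c * invQuadric k ^ 2

theorem totalDegree_pencil_le (c : k) : (pencil c).totalDegree ≤ 4 := by
  have h : (pencil c).IsHomogeneous 4 := by
    have hX := isHomogeneous_X (σ := Fin 5) k
    have h3 : ∀ i : Fin 5, (X i ^ 3 : MvPolynomial (Fin 5) k).IsHomogeneous 3 := fun i => by
      simpa using (hX i).pow 3
    have hq : (invQuadric k).IsHomogeneous 2 :=
      ((by simpa using (hX 0).pow 2 : (X 0 ^ 2 : MvPolynomial (Fin 5) k).IsHomogeneous 2).add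
        ((hX 1).mul (hX 2))).add ((hX 3).mul (hX 4))
    have h0 : (-X 0 ^ 4 : MvPolynomial (Fin 5) k).IsHomogeneous 4 := by
      simpa using ((hX 0).pow 4).neg
    have h5 : (C 3 * (X 1 * X 2 * X 3 * X 4) : MvPolynomial (Fin 5) k).IsHomogeneous 4 := by
      have := (isHomogeneous_C (Fin 5) (3 : k)).mul ((((hX 1).mul (hX 2)).mul (hX 3)).mul (hX 4))
      simpa using this
    refine ((h0.add ((hX 0).mul ((((h3 1).add (h3 2)).sub (h3 3)).sub (h3 4)))).sub h5).add ?_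
    simpa using (isHomogeneous_C (Fin 5) c).mul (hq.pow 2)
  exact h.totalDegree_le

/-- Restriction to the hyperplane `n = 0`. -/
def restrict : MvPolynomial (Fin 5) k →ₐ[k] MvPolynomial (Fin 5) k :=
  aeval ![0, X 1, X 2, X 3, X 4]

theorem restrict_pencil (c : k) : restrict (pencil c) =
    C c * (X 1 * X 2 + X 3 * X 4) ^ 2 - C 3 * (X 1 * X 2 * X 3 * X 4) := by
  simp [restrict, pencil, burkhardt, invQuadric]
  ring

theorem not_X_dvd_of_eval_ne_zero {σ : Type*} {i : σ} {p : MvPolynomial σ k} (v : σ → k)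
    (hi : v i = 0) (hp : eval v p ≠ 0) : ¬ X i ∣ p := by
  rintro ⟨q, rfl⟩
  simp [hi] at hp

theorem irreducible_mul_sub_mul {r : k} (hr : r ≠ 0) :
    Irreducible (X 1 * X 2 - C r * (X 3 * X 4) : MvPolynomial (Fin 5) k) := by
  have key := irreducible_mul_X_add (X 2 : MvPolynomial (Fin 5) k) (-C r * (X 3 * X 4)) 1
    (X_ne_zero 2) ?_ ?_ ?_
  · convert key using 1
    ring
  · simp [vars_X]
  · intro h
    have := vars_mul _ _ h
    simp only [Finset.mem_union] at this
    rcases this with h | h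
    · rw [← C_neg, vars_C] at h
      simp at h
    · have := vars_mul _ _ h
      simp [vars_X] at this
  · refine ((X_prime (σ := Fin 5) (R := k) (i := 2)).irreducible.isRelPrime_iff_not_dvd).mpr ?_
    refine not_X_dvd_of_eval_ne_zero ![0, 0, 0, 1, 1] rfl ?_
    simpa using hr

theorem exists_dvd_of_dvd_mul_prod {R ι : Type*} [CommRing R] [IsDomain R]
    [UniqueFactorizationMonoid R] {s : Finset ι} {f : ι → R} (hf : ∀ i ∈ s, Prime (f i)) {u D : R}
    (hu : IsUnit u) (hD : ¬ IsUnit D) (h : D ∣ u * ∏ i ∈ s, f i) : ∃ i ∈ s, f i ∣ D := by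
  have h0 : u * ∏ i ∈ s, f i ≠ 0 :=
    mul_ne_zero hu.ne_zero (Finset.prod_ne_zero_iff.mpr fun i hi => (hf i hi).ne_zero)
  obtain ⟨p, hp, hpD⟩ := WfDvdMonoid.exists_irreducible_factor hD (ne_zero_of_dvd_ne_zero h0 h)
  have hpp := hp.prime
  have h1 := (hu.dvd_mul_left).mp (hpD.trans h)
  obtain ⟨i, hi, hpi⟩ := (hpp.dvd_finsetProd_iff f).mp h1
  exact ⟨i, hi, ((hpp.associated_of_dvd (hf i hi) hpi).symm.dvd).trans hpD⟩

/-- The factors of the quartic surface `n = 0` in the pencil all pass through at least three of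
the four coordinate points `e₁, …, e₄`. -/
theorem exists_eval_single_eq_zero [IsAlgClosed k] [CharZero k] (c : k)
    {D : MvPolynomial (Fin 5) k} (hD : ¬ IsUnit D) (h : D ∣ restrict (pencil c)) :
    ∃ i : Fin 5, ∀ l : Fin 5, l ≠ 0 → l ≠ i → eval (Pi.single l 1) D = 0 := by
  rw [restrict_pencil] at h
  have hC (a : k) (ha : a ≠ 0) : IsUnit (C a : MvPolynomial (Fin 5) k) := (ha.isUnit).map C
  by_cases hc : c = 0
  · have : C c * (X 1 * X 2 + X 3 * X 4) ^ 2 - C 3 * (X 1 * X 2 * X 3 * X 4) =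
        C (-3 : k) * ∏ i ∈ ({1, 2, 3, 4} : Finset (Fin 5)), X i := by
      simp [hc]
      ring
    rw [this] at h
    obtain ⟨i, -, q, rfl⟩ := exists_dvd_of_dvd_mul_prod (fun i _ => X_prime)
      (hC _ (by norm_num)) hD h
    exact ⟨i, fun l _ hl => by simp [Pi.single_eq_of_ne (Ne.symm hl)]⟩
  · -- `c (p + q)² - 3pq = c (p - rq) (p - sq)` with `rs = 1` and `r + s = 3 / c - 2`.
    obtain ⟨r, hr⟩ := IsAlgClosed.exists_root
      (Polynomial.X ^ 2 + Polynomial.C (2 - 3 / c) * Polynomial.X + Polynomial.C 1)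
      (ne_of_eq_of_ne (b := 2) (by compute_degree!) (by decide))
    have hr : r ^ 2 + (2 - 3 / c) * r + 1 = 0 := by simpa using hr
    have hr0 : r ≠ 0 := by
      rintro rfl
      simp at hr
    have : C c * (X 1 * X 2 + X 3 * X 4) ^ 2 - C 3 * (X 1 * X 2 * X 3 * X 4) =
        C c * ∏ i : Bool, (X 1 * X 2 - C (cond i r r⁻¹) * (X 3 * X 4) :
          MvPolynomial (Fin 5) k) := by
      have e1 : (C r * C r⁻¹ : MvPolynomial (Fin 5) k) = 1 := by
        rw [← C_mul, mul_inv_cancel₀ hr0, C_1]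
      have e2 : (C c * (C r + C r⁻¹ + 1 + 1) : MvPolynomial (Fin 5) k) = C 3 := by
        rw [← C_1, ← C_add, ← C_add, ← C_add, ← C_mul]
        congr 1
        field_simp at hr ⊢
        linear_combination hr
      simp only [Fintype.prod_bool, cond_true, cond_false]
      linear_combination (X 1 * X 2 * X 3 * X 4) * e2 - C c * (X 3 * X 4) ^ 2 * e1
    rw [this] at h
    obtain ⟨i, -, q, rfl⟩ := exists_dvd_of_dvd_mul_prod
      (fun i _ => (irreducible_mul_sub_mul (r := cond i r r⁻¹) (by cases i <;> simpa)).prime)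
      (hC _ hc) hD h
    refine ⟨0, fun l hl _ => ?_⟩
    fin_cases l <;> simp at hl ⊢

/-- Restriction to the affine line through the coordinate point `e_l` in the direction of `n`. -/
def restrictLine (l : Fin 5) : MvPolynomial (Fin 5) k →ₐ[k] Polynomial k :=
  aeval fun i => if i = 0 then Polynomial.X else if i = l then 1 else 0

theorem coeff_one_restrictLine_pencil (c : k) {l : Fin 5} (hl : l ≠ 0) :
    (restrictLine l (pencil c)).coeff 1 ≠ 0 := by
  fin_cases l
  · simp at hl
  all_goals
    simp [restrictLine, pencil, burkhardt, invQuadric, Polynomial.coeff_X_pow, ← pow_mul,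
      Polynomial.coeff_C_mul]

theorem coeff_zero_restrictLine {l : Fin 5} {D : MvPolynomial (Fin 5) k}
    (h : eval (Pi.single l 1) (restrict D) = 0) : (restrictLine l D).coeff 0 = 0 := by
  rw [Polynomial.coeff_zero_eq_aeval_zero]
  refine Eq.trans ?_ h
  have : (Polynomial.aeval (0 : k)).comp (restrictLine (k := k) l) =
      (aeval (Pi.single l (1 : k) : Fin 5 → k)).comp (restrict (k := k)) := by
    ext i
    fin_cases i <;> simp [restrictLine, restrict, Pi.single_apply] <;>
      split_ifs <;> simp_all
  exact DFunLike.congr_fun this D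

/-- A factor of a quartic of the pencil is constant if its restriction to `n = 0` is. -/
theorem isUnit_of_isUnit_restrict [CharZero k] {c : k} {G H : MvPolynomial (Fin 5) k}
    (h : pencil c = G * H) (hH : IsUnit (restrict H)) : IsUnit H := by
  classical
  let w : k := if c = 0 then 1 else 0
  let τ : MvPolynomial (Fin 5) k →ₐ[k] Polynomial k :=
    aeval fun i => Polynomial.C ((![0, 1, 1, w, w] : Fin 5 → k) i) * Polynomial.X
  have hw : c * (1 + w ^ 2) ^ 2 - 3 * w ^ 2 ≠ 0 := by
    by_cases hc : c = 0 <;> simp [w, hc]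
  have hτ : τ.comp restrict = τ := by
    ext1 i
    fin_cases i <;> simp [τ, restrict]
  have h4 : τ (pencil c) = Polynomial.C (c * (1 + w ^ 2) ^ 2 - 3 * w ^ 2) * Polynomial.X ^ 4 := by
    simp [τ, pencil, burkhardt, invQuadric]
    ring
  have h0 : τ (pencil c) ≠ 0 := by
    rw [h4]
    exact mul_ne_zero (Polynomial.C_ne_zero.mpr hw) (by simp)
  have hF0 : pencil c ≠ 0 := fun e => h0 (by rw [e, map_zero])
  have hu : (τ H).natDegree = 0 := by
    rw [← hτ]
    exact Polynomial.natDegree_eq_zero_of_isUnit (hH.map τ)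
  have hG : (τ G).natDegree = 4 := by
    have h1 : (τ (pencil c)).natDegree = 4 := by
      rw [h4, Polynomial.natDegree_C_mul_X_pow _ _ hw]
    rw [h, map_mul] at h0
    rw [h, map_mul, Polynomial.natDegree_mul (left_ne_zero_of_mul h0) (right_ne_zero_of_mul h0),
      hu] at h1
    exact h1
  have hG' : 4 ≤ G.totalDegree := by
    have := aeval_natDegree_le G le_rfl
      (fun i => Polynomial.C ((![0, 1, 1, w, w] : Fin 5 → k) i) * Polynomial.X) (n := 1)
      (fun i => Polynomial.natDegree_C_mul_le _ _ |>.trans Polynomial.natDegree_X_le)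
    change (τ G).natDegree ≤ _ at this
    omega
  have hle := totalDegree_pencil_le c
  rw [h] at hF0 hle
  rw [totalDegree_mul_of_isDomain (left_ne_zero_of_mul hF0) (right_ne_zero_of_mul hF0)] at hle
  have hH0 : H.totalDegree = 0 := by omega
  rw [totalDegree_eq_zero_iff_eq_C] at hH0
  rw [hH0] at hF0 ⊢
  refine (IsUnit.mk0 _ fun e => ?_).map C
  simp [e] at hF0

/-- Each quartic of the pencil is irreducible. Two factors whose restrictions to `n = 0` are not
constant would both vanish at a coordinate point `e_l`, so that the quartic would be singular
there. -/
theorem irreducible_pencil [IsAlgClosed k] [CharZero k] (c : k) : Irreducible (pencil c) := by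
  refine ⟨fun hu => ?_, fun G H h => ?_⟩
  · have := (hu.map (restrictLine (1 : Fin 5)))
    obtain ⟨a, -, ha⟩ := Polynomial.isUnit_iff.mp this
    refine coeff_one_restrictLine_pencil c (l := 1) (by decide) ?_
    rw [← ha, Polynomial.coeff_C_succ]
  by_contra! hGH
  have hG : ¬ IsUnit (restrict G) := fun e =>
    hGH.1 (isUnit_of_isUnit_restrict (h.trans (mul_comm G H)) e)
  have hH : ¬ IsUnit (restrict H) := fun e => hGH.2 (isUnit_of_isUnit_restrict h e)
  have hr : restrict (pencil c) = restrict G * restrict H := by rw [h, map_mul]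
  obtain ⟨i, hi⟩ := exists_eval_single_eq_zero c hG ⟨_, hr⟩
  obtain ⟨j, hj⟩ := exists_eval_single_eq_zero c hH ⟨_, hr.trans (mul_comm _ _)⟩
  obtain ⟨l, hl0, hli, hlj⟩ : ∃ l : Fin 5, l ≠ 0 ∧ l ≠ i ∧ l ≠ j := by
    clear hi hj
    revert i j
    decide
  refine coeff_one_restrictLine_pencil c hl0 ?_
  rw [h, map_mul, Polynomial.mul_coeff_one, coeff_zero_restrictLine (hi l hl0 hli),
    coeff_zero_restrictLine (hj l hl0 hlj)]
  simp

/-! ### Primality of the ideals of the quartics -/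

/-- Linear forms `x₁, …, x₆` with sum zero in terms of `n, m₁, …, m₄`: the three values of
`n + ωⁱ m₁ + ω⁻ⁱ m₂` and the three values of `-n + ωⁱ m₃ + ω⁻ⁱ m₄`. -/
def eigenCoords {R : Type*} [CommRing R] (ω n m₁ m₂ m₃ m₄ : R) : Fin 6 → R :=
  ![n + m₁ + m₂, n + ω * m₁ + ω ^ 2 * m₂, n + ω ^ 2 * m₁ + ω * m₂,
    -n + m₃ + m₄, -n + ω * m₃ + ω ^ 2 * m₄, -n + ω ^ 2 * m₃ + ω * m₄]

section

variable {R : Type*} [CommRing R] {ω : R} (hω : ω ^ 2 + ω + 1 = 0) (n m₁ m₂ m₃ m₄ : R)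

include hω

theorem sum_eigenCoords : ∑ i, eigenCoords ω n m₁ m₂ m₃ m₄ i = 0 := by
  simp [Fin.sum_univ_succ, eigenCoords]
  linear_combination (m₁ + m₂ + m₃ + m₄) * hω

theorem sum_eigenCoords_sq :
    ∑ i, eigenCoords ω n m₁ m₂ m₃ m₄ i ^ 2 = 6 * (n ^ 2 + m₁ * m₂ + m₃ * m₄) := by
  have h2 : ω ^ 2 = -1 - ω := by linear_combination hω
  simp [Fin.sum_univ_succ, eigenCoords, h2]
  ring_nf
  simp only [h2]
  ring

theorem sum_eigenCoords_pow_four :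
    ∑ i, eigenCoords ω n m₁ m₂ m₃ m₄ i ^ 4 =
      12 * (-n ^ 4 + n * (m₁ ^ 3 + m₂ ^ 3 - m₃ ^ 3 - m₄ ^ 3) - 3 * (m₁ * m₂ * m₃ * m₄)) +
        18 * (n ^ 2 + m₁ * m₂ + m₃ * m₄) ^ 2 := by
  have h2 : ω ^ 2 = -1 - ω := by linear_combination hω
  have h3 : ω ^ 3 = 1 := by linear_combination (ω - 1) * hω
  have h4 : ω ^ 4 = ω := by linear_combination ω * h3
  simp [Fin.sum_univ_succ, eigenCoords, h2]
  ring_nf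
  simp only [h2, h3, h4]
  ring

/-- The forms `n, m₁, …, m₄` in terms of `x₁, …, x₆`, where `c` stands for `1 / 3`. -/
def eigenForms {R : Type*} [CommRing R] (ω c : R) (x : Fin 6 → R) : Fin 5 → R :=
  ![c * (x 0 + x 1 + x 2), c * (x 0 + ω ^ 2 * x 1 + ω * x 2), c * (x 0 + ω * x 1 + ω ^ 2 * x 2),
    c * (x 3 + ω ^ 2 * x 4 + ω * x 5), c * (x 3 + ω * x 4 + ω ^ 2 * x 5)]

theorem sub_eigenCoords_eigenForms {c : R} (hc : 3 * c = 1) (x : Fin 6 → R) (i : Fin 6) :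
    x i - eigenCoords ω (eigenForms ω c x 0) (eigenForms ω c x 1) (eigenForms ω c x 2)
      (eigenForms ω c x 3) (eigenForms ω c x 4) i =
      (![0, 0, 0, c, c, c] : Fin 6 → R) i * ∑ j, x j := by
  have h3 : ω ^ 3 = 1 := by linear_combination (ω - 1) * hω
  have h4 : ω ^ 4 = ω := by linear_combination ω * h3
  have h2 : ω ^ 2 = -1 - ω := by linear_combination hω
  have key (y : R) : y = 3 * c * y := by rw [hc, one_mul]
  fin_cases i <;> simp [Fin.sum_univ_succ, eigenCoords, eigenForms] <;> ring_nf <;>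
    simp only [h2, h3, h4] <;> ring_nf
  · linear_combination -x 0 * hc
  · linear_combination -x 1 * hc
  · linear_combination -x 2 * hc
  · linear_combination -x 3 * hc
  · linear_combination -x 4 * hc
  · linear_combination -x 5 * hc

theorem eigenForms_eigenCoords {c : R} (hc : 3 * c = 1) (j : Fin 5) :
    eigenForms ω c (eigenCoords ω n m₁ m₂ m₃ m₄) j = (![n, m₁, m₂, m₃, m₄] : Fin 5 → R) j := by
  have h3 : ω ^ 3 = 1 := by linear_combination (ω - 1) * hω
  have h4 : ω ^ 4 = ω := by linear_combination ω * h3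
  have h2 : ω ^ 2 = -1 - ω := by linear_combination hω
  fin_cases j <;> simp [eigenCoords, eigenForms] <;> ring_nf <;>
    simp only [h2, h3, h4] <;> ring_nf
  · linear_combination n * hc
  · linear_combination m₁ * hc
  · linear_combination m₂ * hc
  · linear_combination m₃ * hc
  · linear_combination m₄ * hc

end

theorem sum_X_mem_quarticIdeal (t : k) : ∑ i, X i ∈ (quarticIdeal t).toIdeal := by
  have : psum (Fin 6) k 1 ∈ (quarticIdeal t).toIdeal := Ideal.subset_span (by simp)
  simpa [psum] using this

/-- The homomorphism of `k`-algebras expressing `x₁, …, x₆` in terms of `n, m₁, …, m₄`. -/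
def eliminate (ω : k) : MvPolynomial (Fin 6) k →ₐ[k] MvPolynomial (Fin 5) k :=
  aeval (eigenCoords (C ω) (X 0) (X 1) (X 2) (X 3) (X 4))

/-- The homomorphism of `k`-algebras expressing `n, m₁, …, m₄` in terms of `x₁, …, x₆`. -/
def eliminateSection (ω : k) : MvPolynomial (Fin 5) k →ₐ[k] MvPolynomial (Fin 6) k :=
  aeval (eigenForms (C ω) (C (1 / 3)) X)

theorem C_omega {σ : Type*} {ω : k} (hω : ω ^ 2 + ω + 1 = 0) :
    (C ω : MvPolynomial σ k) ^ 2 + C ω + 1 = 0 := by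
  rw [← C_pow, ← C_add, ← C_1, ← C_add, hω, C_0]

theorem C_three_mul [CharZero k] {σ : Type*} : 3 * (C (1 / 3) : MvPolynomial σ k) = 1 := by
  rw [show (3 : MvPolynomial σ k) = C 3 from rfl, ← C_mul]
  norm_num

theorem eliminate_quartic {ω : k} (hω : ω ^ 2 + ω + 1 = 0) [CharZero k] (t : k) :
    eliminate ω (psum (Fin 6) k 4 - C t * psum (Fin 6) k 2 ^ 2) =
      C 12 * pencil (3 * (1 / 2 - t)) := by
  have h4 := sum_eigenCoords_pow_four (C_omega (σ := Fin 5) hω) (X 0) (X 1) (X 2) (X 3) (X 4)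
  have h2 := sum_eigenCoords_sq (C_omega (σ := Fin 5) hω) (X 0) (X 1) (X 2) (X 3) (X 4)
  have e (d : ℕ) : eliminate ω (psum (Fin 6) k d) =
      ∑ i, eigenCoords (C ω) (X 0) (X 1) (X 2) (X 3) (X 4 : MvPolynomial (Fin 5) k) i ^ d := by
    simp [psum, eliminate]
  have ht : eliminate ω (C t) = C t := (eliminate ω).commutes t
  have hC : (C (3 * (1 / 2 - t)) : MvPolynomial (Fin 5) k) = C 3 * (C (1 / 2) - C t) := by
    rw [C_mul, C_sub]
  have h12 : (C 12 : MvPolynomial (Fin 5) k) = 12 := rfl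
  have h3 : (C 3 : MvPolynomial (Fin 5) k) = 3 := rfl
  have hh : (2 : MvPolynomial (Fin 5) k) * C (1 / 2) = 1 := by
    rw [show (2 : MvPolynomial (Fin 5) k) = C 2 from rfl, ← C_mul]
    norm_num
  rw [map_sub, map_mul, map_pow, e, e, h4, h2, ht, pencil, burkhardt, invQuadric, hC, h12, h3]
  linear_combination (-18 * (X 0 ^ 2 + X 1 * X 2 + X 3 * X 4) ^ 2) * hh

theorem quarticIdeal_eq_comap [IsAlgClosed k] [CharZero k] {ω : k} (hω : ω ^ 2 + ω + 1 = 0)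
    (t : k) : (quarticIdeal t).toIdeal =
      (Ideal.span {pencil (3 * (1 / 2 - t))}).comap (eliminate ω) := by
  have h12 : IsUnit (C 12 : MvPolynomial (Fin 5) k) :=
    (IsUnit.mk0 (12 : k) (by norm_num)).map C
  refine le_antisymm (Ideal.span_le.mpr ?_) fun g hg => ?_
  · rintro _ (rfl | rfl)
    · have : eliminate ω (psum (Fin 6) k 1) = 0 := by
        simpa [psum, eliminate] using sum_eigenCoords (C_omega (σ := Fin 5) hω) _ _ _ _ _
      rw [SetLike.mem_coe, Ideal.mem_comap, this]
      exact zero_mem _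
    · simp only [Ideal.coe_comap, Set.mem_preimage, SetLike.mem_coe, Ideal.mem_span_singleton]
      rw [eliminate_quartic hω]
      exact Dvd.intro_left _ rfl
  · have hτ : ((Ideal.Quotient.mkₐ k (quarticIdeal t).toIdeal).comp (eliminateSection ω)).comp
        (eliminate ω) = Ideal.Quotient.mkₐ k (quarticIdeal t).toIdeal := by
      ext1 i
      refine (Ideal.Quotient.eq.mpr ?_).symm
      have h1 := sub_eigenCoords_eigenForms (C_omega (σ := Fin 6) hω) C_three_mul X i
      have h2 : eliminateSection ω (eliminate ω (X i)) = eigenCoords (C ω)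
          (eigenForms (C ω) (C (1 / 3)) X 0) (eigenForms (C ω) (C (1 / 3)) X 1)
          (eigenForms (C ω) (C (1 / 3)) X 2) (eigenForms (C ω) (C (1 / 3)) X 3)
          (eigenForms (C ω) (C (1 / 3)) (X : Fin 6 → MvPolynomial (Fin 6) k) 4) i := by
        have hc : eliminateSection ω (C ω) = C ω := (eliminateSection ω).commutes ω
        have hX (j : Fin 5) : eliminateSection ω (X j) =
          eigenForms (C ω) (C (1 / 3)) (X : Fin 6 → MvPolynomial (Fin 6) k) j := by
          simp [eliminateSection]
        fin_cases i <;> simp [eliminate, eigenCoords, hc, hX]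
      change X i - eliminateSection ω (eliminate ω (X i)) ∈ _
      rw [h2, h1]
      exact Ideal.mul_mem_left _ _ (sum_X_mem_quarticIdeal t)
    have hF : eliminateSection ω (pencil (3 * (1 / 2 - t))) ∈ (quarticIdeal t).toIdeal := by
      have h1 := DFunLike.congr_fun hτ (psum (Fin 6) k 4 - C t * psum (Fin 6) k 2 ^ 2)
      have h0 : Ideal.Quotient.mkₐ k (quarticIdeal t).toIdeal
          (psum (Fin 6) k 4 - C t * psum (Fin 6) k 2 ^ 2) = 0 :=
        Ideal.Quotient.eq_zero_iff_mem.mpr (Ideal.subset_span (by simp))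
      rw [h0, AlgHom.comp_apply, eliminate_quartic hω, map_mul,
        (h12.map _).mul_right_eq_zero] at h1
      exact Ideal.Quotient.eq_zero_iff_mem.mp h1
    obtain ⟨h, hh⟩ := Ideal.mem_span_singleton.mp (Ideal.mem_comap.mp hg)
    have h1 := DFunLike.congr_fun hτ g
    refine Ideal.Quotient.eq_zero_iff_mem.mp (h1.symm.trans ?_)
    refine Ideal.Quotient.eq_zero_iff_mem.mpr ?_
    change eliminateSection ω (eliminate ω g) ∈ _
    rw [hh, map_mul]
    exact Ideal.mul_mem_right _ _ hF

theorem exists_omega [IsAlgClosed k] : ∃ ω : k, ω ^ 2 + ω + 1 = 0 := by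
  obtain ⟨ω, h⟩ := IsAlgClosed.exists_root
    (Polynomial.X ^ 2 + Polynomial.X + Polynomial.C (1 : k))
    (ne_of_eq_of_ne (b := 2) (by compute_degree!) (by decide))
  exact ⟨ω, by simpa using h⟩

instance isPrime_quarticIdeal [IsAlgClosed k] [CharZero k] (t : k) :
    (quarticIdeal t).toIdeal.IsPrime := by
  obtain ⟨ω, hω⟩ := exists_omega (k := k)
  rw [quarticIdeal_eq_comap hω]
  have := (Ideal.span_singleton_prime (irreducible_pencil (3 * (1 / 2 - t))).ne_zero).mpr
    (irreducible_pencil (3 * (1 / 2 - t))).prime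
  exact Ideal.comap_isPrime _ _

end CobleFourfold

/-! ### Primality of the ideal of the threefold in the Coble fourfold -/

namespace CobleFourfold

/-- An element of a factorial domain which acquires a simple zero under a specialization to a
polynomial ring in one variable is not a square in the fraction field. -/
theorem eq_zero_of_mul_sq_eq_sq {R F : Type*} [CommRing R] [IsDomain R] [IsIntegrallyClosed R]
    [CommRing F] [IsDomain F] (φ : R →+* Polynomial F) {f : R} (h0 : (φ f).coeff 0 = 0)
    (h1 : (φ f).coeff 1 ≠ 0) {g h : R} (e : f * h ^ 2 = g ^ 2) : h = 0 := by
  by_contra hh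
  have hd : h ^ 2 ∣ g ^ 2 := ⟨f, by rw [← e, mul_comm]⟩
  obtain ⟨r, rfl⟩ := (IsIntegrallyClosed.pow_dvd_pow_iff two_ne_zero).mp hd
  have hf : f = r ^ 2 := by
    refine mul_right_cancel₀ (pow_ne_zero 2 hh) ?_
    rw [e]
    ring
  rw [hf, map_pow, sq] at h0 h1
  rw [Polynomial.mul_coeff_zero, mul_self_eq_zero] at h0
  simp [Polynomial.mul_coeff_one, h0] at h1

/-- Independence of `1, N, Z, NZ` over a domain `P`, for square roots `N` of `D` and `Z` of
`β + γN`, when neither `D` nor the norm of `β + γN` is a square in the fraction field. -/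
theorem eq_zero_of_add_eq_zero {P K : Type*} [CommRing P] [IsDomain P] [Field K] (i : P →+* K)
    (hi : Function.Injective i) {D β γ : P} (hD : ∀ g h : P, D * h ^ 2 = g ^ 2 → h = 0)
    (hβ : ∀ g h : P, (β ^ 2 - D * γ ^ 2) * h ^ 2 = g ^ 2 → h = 0) {N Z : K} (hN : N ^ 2 = i D)
    (hZ : Z ^ 2 = i β + N * i γ) {g₀ g₁ g₂ g₃ : P}
    (h : i g₀ + i g₁ * N + Z * (i g₂ + i g₃ * N) = 0) :
    g₀ = 0 ∧ g₁ = 0 ∧ g₂ = 0 ∧ g₃ = 0 := by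
  have hN1 {a b : P} (hab : i a + i b * N = 0) : a = 0 ∧ b = 0 := by
    have hb : b = 0 := hD a b <| hi <| by
      simp only [map_mul, map_pow]
      linear_combination (i b * N - i a) * hab - i b ^ 2 * hN
    refine ⟨hi ?_, hb⟩
    simpa [hb] using hab
  obtain ⟨ha, hb⟩ := @hN1
    (g₀ ^ 2 + D * g₁ ^ 2 - (β * (g₂ ^ 2 + D * g₃ ^ 2) + 2 * γ * D * g₂ * g₃))
    (2 * g₀ * g₁ - (γ * (g₂ ^ 2 + D * g₃ ^ 2) + 2 * β * g₂ * g₃)) <| by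
      simp only [map_sub, map_add, map_mul, map_pow, map_ofNat]
      linear_combination (i g₀ + i g₁ * N - Z * (i g₂ + i g₃ * N)) * h +
        (i g₂ + i g₃ * N) ^ 2 * hZ +
        (-i g₁ ^ 2 + i g₃ ^ 2 * (i β + N * i γ) + 2 * i γ * i g₂ * i g₃) * hN
  have h2 := hβ (g₀ ^ 2 - D * g₁ ^ 2) (g₂ ^ 2 - D * g₃ ^ 2) <| by
    linear_combination
      -(g₀ ^ 2 + D * g₁ ^ 2 + (β * (g₂ ^ 2 + D * g₃ ^ 2) + 2 * γ * D * g₂ * g₃)) * ha +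
      D * (2 * g₀ * g₁ + (γ * (g₂ ^ 2 + D * g₃ ^ 2) + 2 * β * g₂ * g₃)) * hb
  have h3 : g₃ = 0 := hD g₂ g₃ (by linear_combination -h2)
  have h2 : g₂ = 0 := by simpa [h3] using h2
  obtain ⟨h0, h1⟩ := hN1 (a := g₀) (b := g₁) (by simpa [h2, h3] using h)
  exact ⟨h0, h1, h2, h3⟩

variable {k : Type u} [Field k]

variable (k) in
/-- The value of `n²` on the quadric `n² + m₁m₂ + m₃m₄ = 0`, as a polynomial in `m₁, …, m₄`. -/
def nSq : MvPolynomial (Fin 4) k := -(X 0 * X 1 + X 2 * X 3)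

variable (k) in
/-- The part of the value of the Burkhardt quartic on the quadric `n² + m₁m₂ + m₃m₄ = 0` which is
free of `n`. -/
def constPart : MvPolynomial (Fin 4) k := -nSq k ^ 2 - 3 * (X 0 * X 1 * X 2 * X 3)

variable (k) in
/-- The coefficient of `n` in the Burkhardt quartic. -/
def linearPart : MvPolynomial (Fin 4) k := X 0 ^ 3 + X 1 ^ 3 - X 2 ^ 3 - X 3 ^ 3

/-- Restriction to the line `(T, -1, 0, 0)`. -/
def restrictRamified : MvPolynomial (Fin 4) k →+* Polynomial k :=
  (aeval ![Polynomial.X, -1, 0, 0] : MvPolynomial (Fin 4) k →ₐ[k] Polynomial k)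

theorem nSq_not_square {g h : MvPolynomial (Fin 4) k} (e : nSq k * h ^ 2 = g ^ 2) : h = 0 := by
  have : restrictRamified (nSq k) = Polynomial.X := by simp [restrictRamified, nSq]
  exact eq_zero_of_mul_sq_eq_sq restrictRamified (by simp [this]) (by simp [this]) e

theorem norm_not_square [CharZero k] {g h : MvPolynomial (Fin 4) k}
    (e : ((12 * constPart k) ^ 2 - nSq k * (12 * linearPart k) ^ 2) * h ^ 2 = g ^ 2) : h = 0 := by
  have h1 : restrictRamified (nSq k) = Polynomial.X := by simp [restrictRamified, nSq]
  have h2 : restrictRamified (linearPart k) = Polynomial.X ^ 3 - 1 := by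
    simp [restrictRamified, linearPart]
    ring
  have h3 : restrictRamified (constPart k) = - Polynomial.X ^ 2 := by
    simp only [constPart, map_sub, map_neg, map_pow, h1]
    simp [restrictRamified]
  have h4 : restrictRamified ((12 * constPart k) ^ 2 - nSq k * (12 * linearPart k) ^ 2) =
      Polynomial.C (-144) * Polynomial.X +
        (Polynomial.X ^ 2 * (144 * Polynomial.X ^ 2 - 144 * Polynomial.X ^ 5
          + 288 * Polynomial.X ^ 2)) := by
    simp only [map_sub, map_mul, map_pow, h1, h2, h3, map_neg, map_ofNat]
    ring
  refine eq_zero_of_mul_sq_eq_sq restrictRamified ?_ ?_ e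
  · rw [h4]
    simp
  · rw [h4, Polynomial.coeff_add, Polynomial.coeff_X_pow_mul', Polynomial.coeff_C_mul_X]
    norm_num

theorem coblePsum_mem_one : coblePsum k 1 ∈ (threefoldInftyIdeal k).toIdeal :=
  Ideal.subset_span (by simp)

theorem coblePsum_mem_two : coblePsum k 2 ∈ (threefoldInftyIdeal k).toIdeal :=
  Ideal.subset_span (by simp)

theorem X_zero_sq_sub_mem : X 0 ^ 2 - (coblePsum k 4 - C (1 / 4) * coblePsum k 2 ^ 2) ∈
    (threefoldInftyIdeal k).toIdeal :=
  Ideal.subset_span (by simp)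

section NormalForm

variable [CharZero k] {ω : k} (hω : ω ^ 2 + ω + 1 = 0)

variable (ω) in
/-- The classes of the forms `n, m₁, …, m₄` modulo the equations of the threefold. -/
def inftyForms (i : Fin 5) : MvPolynomial (Fin 7) k ⧸ (threefoldInftyIdeal k).toIdeal :=
  Ideal.Quotient.mk _ (eigenForms (C ω) (C (1 / 3)) (fun j => X j.succ) i)

variable (ω) in
/-- The homomorphism from polynomials in `m₁, …, m₄` to the coordinate ring of the threefold. -/
def inftyHom : MvPolynomial (Fin 4) k →ₐ[k]
    MvPolynomial (Fin 7) k ⧸ (threefoldInftyIdeal k).toIdeal :=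
  aeval fun i => inftyForms ω i.succ

include hω

theorem mk_X_succ (i : Fin 6) :
    Ideal.Quotient.mk (threefoldInftyIdeal k).toIdeal (X i.succ) =
      eigenCoords (algebraMap k _ ω) (inftyForms ω 0) (inftyForms ω 1) (inftyForms ω 2)
        (inftyForms ω 3) (inftyForms ω 4) i := by
  have h1 := sub_eigenCoords_eigenForms (C_omega (σ := Fin 7) hω) C_three_mul
    (fun j : Fin 6 => X j.succ) i
  have h2 := congrArg (Ideal.Quotient.mk (threefoldInftyIdeal k).toIdeal) h1
  have h3 : Ideal.Quotient.mk (threefoldInftyIdeal k).toIdeal (∑ j : Fin 6, X j.succ) = 0 := by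
    simpa [coblePsum] using Ideal.Quotient.eq_zero_iff_mem.mpr (coblePsum_mem_one (k := k))
  rw [map_mul, h3, mul_zero, map_sub, sub_eq_zero] at h2
  rw [h2]
  have hc : Ideal.Quotient.mk (threefoldInftyIdeal k).toIdeal (C ω) = algebraMap k _ ω := rfl
  fin_cases i <;> simp [eigenCoords, inftyForms, hc]

theorem inftyForms_zero_sq : inftyForms ω 0 ^ 2 = inftyHom ω (nSq k) := by
  have hω' : (algebraMap k (MvPolynomial (Fin 7) k ⧸ (threefoldInftyIdeal k).toIdeal) ω) ^ 2 +
      algebraMap k _ ω + 1 = 0 := by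
    rw [← map_pow, ← map_add, ← map_one (algebraMap k _), ← map_add, hω, map_zero]
  have h6 : IsUnit (6 : MvPolynomial (Fin 7) k ⧸ (threefoldInftyIdeal k).toIdeal) := by
    have := (IsUnit.mk0 (6 : k) (by norm_num)).map
      (algebraMap k (MvPolynomial (Fin 7) k ⧸ (threefoldInftyIdeal k).toIdeal))
    rwa [map_ofNat] at this
  have h2 := Ideal.Quotient.eq_zero_iff_mem.mpr (coblePsum_mem_two (k := k))
  simp only [coblePsum, map_sum, map_pow, mk_X_succ hω] at h2
  rw [sum_eigenCoords_sq hω', h6.mul_right_eq_zero] at h2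
  have hn : inftyHom ω (nSq k) =
      -(inftyForms ω 1 * inftyForms ω 2 + inftyForms ω 3 * inftyForms ω 4) := by
    simp only [inftyHom, nSq, map_neg, map_add, map_mul, aeval_X]
    rfl
  rw [hn]
  linear_combination h2

theorem mk_X_zero_sq : Ideal.Quotient.mk (threefoldInftyIdeal k).toIdeal (X 0) ^ 2 =
    inftyHom ω (12 * constPart k) + inftyForms ω 0 * inftyHom ω (12 * linearPart k) := by
  have hω' : (algebraMap k (MvPolynomial (Fin 7) k ⧸ (threefoldInftyIdeal k).toIdeal) ω) ^ 2 +
      algebraMap k _ ω + 1 = 0 := by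
    rw [← map_pow, ← map_add, ← map_one (algebraMap k _), ← map_add, hω, map_zero]
  have h2 := Ideal.Quotient.eq_zero_iff_mem.mpr (coblePsum_mem_two (k := k))
  have h4 := Ideal.Quotient.eq_zero_iff_mem.mpr (X_zero_sq_sub_mem (k := k))
  rw [map_sub, map_sub, map_mul, map_pow, map_pow, h2] at h4
  have hn := inftyForms_zero_sq hω
  have e4 : Ideal.Quotient.mk (threefoldInftyIdeal k).toIdeal (coblePsum k 4) =
      ∑ i, eigenCoords (algebraMap k _ ω) (inftyForms ω 0) (inftyForms ω 1) (inftyForms ω 2)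
        (inftyForms ω 3) (inftyForms ω 4) i ^ 4 := by
    simp only [coblePsum, map_sum, map_pow, mk_X_succ hω]
  rw [e4, sum_eigenCoords_pow_four hω'] at h4
  have hn' : inftyHom ω (nSq k) =
      -(inftyForms ω 1 * inftyForms ω 2 + inftyForms ω 3 * inftyForms ω 4) := by
    simp only [inftyHom, nSq, map_neg, map_add, map_mul, aeval_X]
    rfl
  have hl : inftyHom ω (linearPart k) = inftyForms ω 1 ^ 3 + inftyForms ω 2 ^ 3 -
      inftyForms ω 3 ^ 3 - inftyForms ω 4 ^ 3 := by
    simp only [inftyHom, linearPart, map_sub, map_add, map_pow, aeval_X]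
    rfl
  have hp : inftyHom ω (X 0 * X 1 * X 2 * X 3) =
      inftyForms ω 1 * inftyForms ω 2 * inftyForms ω 3 * inftyForms ω 4 := by
    simp only [inftyHom, map_mul, aeval_X]
    rfl
  rw [constPart, map_mul, map_mul, map_sub, map_neg, map_pow, map_mul, hn', hl, hp]
  rw [hn'] at hn
  simp only [map_ofNat]
  linear_combination h4 + (18 * (inftyForms ω 0 ^ 2 + inftyForms ω 1 * inftyForms ω 2 +
    inftyForms ω 3 * inftyForms ω 4) - 12 * (inftyForms ω 0 ^ 2 - inftyForms ω 1 * inftyForms ω 2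
      - inftyForms ω 3 * inftyForms ω 4)) * hn

/-- The coordinate ring of the affine cone over the threefold is generated by `1, n, x₀, n x₀` as
a module over the polynomials in `m₁, …, m₄`. -/
theorem exists_normalForm (x : MvPolynomial (Fin 7) k ⧸ (threefoldInftyIdeal k).toIdeal) :
    ∃ g₀ g₁ g₂ g₃ : MvPolynomial (Fin 4) k,
      x = inftyHom ω g₀ + inftyHom ω g₁ * inftyForms ω 0 +
        Ideal.Quotient.mk _ (X 0) * (inftyHom ω g₂ + inftyHom ω g₃ * inftyForms ω 0) := by
  obtain ⟨g, rfl⟩ := Ideal.Quotient.mk_surjective x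
  have hn := inftyForms_zero_sq hω
  have hz := mk_X_zero_sq hω
  induction g using MvPolynomial.induction_on with
  | C a =>
    refine ⟨C a, 0, 0, 0, ?_⟩
    have : inftyHom ω (C a) = Ideal.Quotient.mk (threefoldInftyIdeal k).toIdeal (C a) :=
      (inftyHom ω).commutes a
    rw [this]
    simp only [map_zero, zero_mul, mul_zero, add_zero]
  | add p q hp hq =>
    obtain ⟨a₀, a₁, a₂, a₃, ha⟩ := hp
    obtain ⟨b₀, b₁, b₂, b₃, hb⟩ := hq
    refine ⟨a₀ + b₀, a₁ + b₁, a₂ + b₂, a₃ + b₃, ?_⟩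
    simp only [map_add, ha, hb]
    ring
  | mul_X p i hp =>
    obtain ⟨a₀, a₁, a₂, a₃, ha⟩ := hp
    cases i using Fin.cases with
    | zero =>
      refine ⟨12 * constPart k * a₂ + nSq k * (12 * linearPart k) * a₃,
        12 * constPart k * a₃ + 12 * linearPart k * a₂, a₀, a₁, ?_⟩
      rw [map_mul, ha]
      simp only [map_add, map_mul _ _ a₂, map_mul _ _ a₃, map_mul _ (nSq k)]
      linear_combination (inftyHom ω a₂ + inftyHom ω a₃ * inftyForms ω 0) * hz +
        inftyHom ω (12 * linearPart k) * inftyHom ω a₃ * hn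
    | succ i =>
      obtain ⟨s, l, hl⟩ : ∃ (s : k) (l : MvPolynomial (Fin 4) k),
          Ideal.Quotient.mk (threefoldInftyIdeal k).toIdeal (X i.succ) =
            inftyHom ω (C s) * inftyForms ω 0 + inftyHom ω l := by
        rw [mk_X_succ hω]
        have hX (j : Fin 4) : inftyHom ω (X j) = inftyForms ω j.succ := by simp [inftyHom]
        have hC (c : k) : inftyHom ω (C c) = algebraMap k _ c := (inftyHom ω).commutes c
        refine ⟨(![1, 1, 1, -1, -1, -1] : Fin 6 → k) i,
          (![X 0 + X 1, C ω * X 0 + C ω ^ 2 * X 1, C ω ^ 2 * X 0 + C ω * X 1,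
            X 2 + X 3, C ω * X 2 + C ω ^ 2 * X 3, C ω ^ 2 * X 2 + C ω * X 3] :
              Fin 6 → MvPolynomial (Fin 4) k) i, ?_⟩
        fin_cases i <;> simp [eigenCoords, hX, hC] <;> ring
      refine ⟨a₀ * l + nSq k * (C s * a₁), a₁ * l + C s * a₀,
        a₂ * l + nSq k * (C s * a₃), a₃ * l + C s * a₂, ?_⟩
      rw [map_mul, ha, hl]
      simp only [map_add, map_mul]
      linear_combination (inftyHom ω (C s) * (inftyHom ω a₁ +
        Ideal.Quotient.mk (threefoldInftyIdeal k).toIdeal (X 0) * inftyHom ω a₃)) * hn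

end NormalForm

instance isPrime_threefoldInftyIdeal [IsAlgClosed k] [CharZero k] :
    (threefoldInftyIdeal k).toIdeal.IsPrime := by
  obtain ⟨ω, hω⟩ := exists_omega (k := k)
  let K := AlgebraicClosure (FractionRing (MvPolynomial (Fin 4) k))
  have hinj : Function.Injective (algebraMap (MvPolynomial (Fin 4) k) K) := by
    rw [IsScalarTower.algebraMap_eq (MvPolynomial (Fin 4) k)
      (FractionRing (MvPolynomial (Fin 4) k)) K]
    exact (algebraMap (FractionRing (MvPolynomial (Fin 4) k)) K).injective.comp
      (IsFractionRing.injective _ _)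
  let i := algebraMap (MvPolynomial (Fin 4) k) K
  obtain ⟨N, hN⟩ := IsAlgClosed.exists_pow_nat_eq (i (nSq k)) two_pos
  obtain ⟨Z, hZ⟩ := IsAlgClosed.exists_pow_nat_eq
    (i (12 * constPart k) + N * i (12 * linearPart k)) two_pos
  let θ : MvPolynomial (Fin 7) k →ₐ[k] K := aeval (Fin.cons Z
    (eigenCoords (algebraMap k K ω) N (i (X 0)) (i (X 1)) (i (X 2)) (i (X 3))))
  have hω' : algebraMap k K ω ^ 2 + algebraMap k K ω + 1 = 0 := by
    rw [← map_pow, ← map_add, ← map_one (algebraMap k _), ← map_add, hω, map_zero]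
  have hsum (d : ℕ) : θ (coblePsum k d) = ∑ j, eigenCoords (algebraMap k K ω) N (i (X 0))
      (i (X 1)) (i (X 2)) (i (X 3)) j ^ d := by
    simp [θ, coblePsum]
  have hq : N ^ 2 + i (X 0) * i (X 1) + i (X 2) * i (X 3) = 0 := by
    rw [hN, nSq]
    simp only [map_neg, map_add, map_mul]
    ring
  have hθ : ∀ g ∈ (threefoldInftyIdeal k).toIdeal, θ g = 0 := by
    change (threefoldInftyIdeal k).toIdeal ≤ RingHom.ker θ
    refine Ideal.span_le.mpr ?_
    have h2 : θ (coblePsum k 2) = 0 := by rw [hsum, sum_eigenCoords_sq hω', hq, mul_zero]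
    rintro _ (rfl | rfl | rfl)
    · have := (hsum 1).trans (by simpa using sum_eigenCoords hω' _ _ _ _ _)
      exact this
    · have h0 : θ (X 0) = Z := by simp [θ]
      change θ _ = 0
      rw [map_sub, map_sub, map_mul, map_pow, map_pow, h2, hsum, h0, hZ,
        sum_eigenCoords_pow_four hω', hq]
      simp only [constPart, nSq, linearPart, map_sub, map_neg, map_add, map_mul, map_pow,
        map_ofNat]
      linear_combination (12 * (N ^ 2 - i (X 0) * i (X 1) - i (X 2) * i (X 3))) * hq
    · exact h2
  let Θ : (MvPolynomial (Fin 7) k ⧸ (threefoldInftyIdeal k).toIdeal) →ₐ[k] K :=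
    Ideal.Quotient.liftₐ _ θ hθ
  have hΘ : ∀ g, Θ (Ideal.Quotient.mk _ g) = θ g := fun g => rfl
  have h3 : 3 * algebraMap k K (1 / 3) = 1 := by
    rw [← map_ofNat (algebraMap k K), ← map_mul]
    norm_num
  have hforms (j : Fin 5) : Θ (inftyForms ω j) =
      (![N, i (X 0), i (X 1), i (X 2), i (X 3)] : Fin 5 → K) j := by
    rw [← eigenForms_eigenCoords hω' _ _ _ _ _ h3, inftyForms, hΘ]
    have h1 : θ (C ω) = algebraMap k K ω := θ.commutes ω
    have h2 : θ (C (1 / 3)) = algebraMap k K (1 / 3) := θ.commutes _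
    have h4 (l : Fin 6) : θ (X l.succ) = eigenCoords (algebraMap k K ω) N (i (X 0)) (i (X 1))
      (i (X 2)) (i (X 3)) l := by simp [θ]
    fin_cases j <;> simp only [eigenForms, Fin.mk_one, Fin.zero_eta, Fin.reduceFinMk,
      Matrix.cons_val, map_mul, map_add, map_pow, h1, h2, h4]
  have hhom : (Θ.comp (inftyHom ω)) = IsScalarTower.toAlgHom k _ K := by
    ext1 j
    simp only [AlgHom.comp_apply, inftyHom, aeval_X, hforms]
    fin_cases j <;> rfl
  have hinjΘ : Function.Injective Θ := by
    rw [injective_iff_map_eq_zero]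
    intro x hx
    obtain ⟨g₀, g₁, g₂, g₃, rfl⟩ := exists_normalForm hω x
    have hh (g) : Θ (inftyHom ω g) = i g := DFunLike.congr_fun hhom g
    simp only [map_add, map_mul, hh, hforms, hΘ] at hx
    obtain ⟨rfl, rfl, rfl, rfl⟩ := eq_zero_of_add_eq_zero i hinj (fun _ _ => nSq_not_square)
      (fun _ _ => norm_not_square) hN hZ (by simpa [θ] using hx)
    simp
  have := hinjΘ.isDomain Θ.toRingHom
  exact (Ideal.Quotient.isDomain_iff_prime _).mp this

end CobleFourfold

/-! ### Parametrizations by polynomials -/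

namespace CobleFourfold

variable {k : Type u} [Field k]

/-- A prime ideal of a `k`-algebra is the kernel of a point over an algebraically closed field. -/
theorem exists_ker_eq {A : Type u} [CommRing A] [Algebra k A] (I : Ideal A) [I.IsPrime] :
    ∃ (K : Type u) (_ : Field K) (_ : IsAlgClosed K) (_ : Algebra k K) (ι : A →ₐ[k] K),
      RingHom.ker ι = I := by
  let K := AlgebraicClosure (FractionRing (A ⧸ I))
  have hinj : Function.Injective (algebraMap (A ⧸ I) K) := by
    rw [IsScalarTower.algebraMap_eq (A ⧸ I) (FractionRing (A ⧸ I)) K]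
    exact (algebraMap (FractionRing (A ⧸ I)) K).injective.comp (IsFractionRing.injective _ _)
  refine ⟨K, inferInstance, inferInstance, inferInstance,
    (IsScalarTower.toAlgHom k (A ⧸ I) K).comp (Ideal.Quotient.mkₐ k I), ?_⟩
  ext a
  rw [RingHom.mem_ker, ← Ideal.Quotient.eq_zero_iff_mem (I := I)]
  exact map_eq_zero_iff _ hinj

/-- A homomorphism `φ` to a polynomial ring which kills `I` has kernel `I` as soon as the generic
point of `I` is a value of the parametrization defined by `φ`. -/
theorem ker_eq_of_comp_eq {A K n : Type*} [CommRing A] [Algebra k A] [CommRing K] [Algebra k K]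
    {I : Ideal A} {φ : A →ₐ[k] MvPolynomial n k} (hφ : I ≤ RingHom.ker φ) {ι : A →ₐ[k] K}
    (hι : RingHom.ker ι = I) (y : n → K) (h : (aeval y).comp φ = ι) : RingHom.ker φ = I := by
  refine le_antisymm (fun a ha => ?_) hφ
  rw [← hι, RingHom.mem_ker, ← h, AlgHom.comp_apply, RingHom.mem_ker.mp ha, map_zero]

section Specialization

variable {A K F : Type*} [CommRing A] [CommRing K] [CommRing F] {ι : A →+* K} {e : A →+* F}

theorem goodLocus_ne_zero_of_ker_le (h : RingHom.ker ι ≤ RingHom.ker e) {ω z : A} {x : Fin 6 → A}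
    (hne : goodLocus (e ω) (e ∘ x) (e z) ≠ 0) : goodLocus (ι ω) (ι ∘ x) (ι z) ≠ 0 := by
  rw [← map_goodLocus] at hne ⊢
  exact fun h0 => hne (h h0)

theorem conicDisc_ne_zero_of_ker_le (h : RingHom.ker ι ≤ RingHom.ker e) {κ ρ z : A}
    {x : Fin 6 → A} (hne : conicDisc (e κ) (e ρ) (fstPoint (e ∘ x) (e z)) ≠ 0) :
    conicDisc (ι κ) (ι ρ) (fstPoint (ι ∘ x) (ι z)) ≠ 0 := by
  rw [← comp_fstPoint, ← map_conicDisc] at hne ⊢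
  exact fun h0 => hne (h h0)

end Specialization

/-- The index type of the parameters: a point of the base of the conic bundle, a point of the plane
fixing a line through the known point of the conic, and a scalar. -/
abbrev Params : Type u := ULift.{u} (Fin 3 ⊕ Fin 3 ⊕ Unit)

/-- The point with given values of the parameters. -/
def paramValues {K : Type*} (m b : Fin 3 → K) (s : K) (j : Params.{u}) : K :=
  Sum.elim m (Sum.elim b fun _ => s) j.down

/-- The pairs `(a, b)` of points of the plane on the divisor `κ x₀ + ρ ∑ xᵢ² = 0` have a polynomial
parametrization which reaches every general point. -/
theorem exists_parametrization [CharZero k] {ω : k} (hω : ω ^ 2 + ω + 1 = 0) {κ ρ : k}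
    (hκρ : ρ ≠ 0 → 2 * ρ - κ ≠ 0) :
    ∃ a b : Fin 3 → MvPolynomial Params.{u} k, conic (C κ) (C ρ) a b = 0 ∧
      ∀ (K : Type u) [Field K] [IsAlgClosed K] [Algebra k K] (x : Fin 6 → K) (z : K),
        ∑ i, x i = 0 → 4 * z ^ 2 = 4 * ∑ i, x i ^ 4 - (∑ i, x i ^ 2) ^ 2 →
        algebraMap k K κ * z + algebraMap k K ρ * ∑ i, x i ^ 2 = 0 →
        goodLocus (algebraMap k K ω) x z ≠ 0 →
        conicDisc (algebraMap k K κ) (algebraMap k K ρ) (fstPoint x z) ≠ 0 →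
        ∃ y : Params.{u} → K,
          (∀ i, aeval y (coords a b i) = x i) ∧ aeval y (weightTwo a b) = z := by
  let M : Fin 3 → MvPolynomial Params.{u} k := fun j => X ⟨Sum.inl j⟩
  let B : Fin 3 → MvPolynomial Params.{u} k := fun j => X ⟨Sum.inr (Sum.inl j)⟩
  let s : MvPolynomial Params.{u} k := X ⟨Sum.inr (Sum.inr ())⟩
  have hM {K : Type u} [Field K] [Algebra k K] (m b : Fin 3 → K) (t : K) :
      (aeval (paramValues m b t) : MvPolynomial Params.{u} k →ₐ[k] K).toRingHom ∘ M = m := by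
    ext j
    simp [M, paramValues]
  have hB {K : Type u} [Field K] [Algebra k K] (m b : Fin 3 → K) (t : K) :
      (aeval (paramValues m b t) : MvPolynomial Params.{u} k →ₐ[k] K).toRingHom ∘ B = b := by
    ext j
    simp [B, paramValues]
  have hs {K : Type u} [Field K] [Algebra k K] (m b : Fin 3 → K) (t : K) :
      (aeval (paramValues m b t) : MvPolynomial Params.{u} k →ₐ[k] K).toRingHom s = t := by
    simp [s, paramValues]
  have hC {K : Type u} [Field K] [Algebra k K] (y : Params.{u} → K) (c : k) :
      (aeval y : MvPolynomial Params.{u} k →ₐ[k] K).toRingHom (C c) = algebraMap k K c :=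
    (aeval y : MvPolynomial Params.{u} k →ₐ[k] K).commutes c
  have hsmul {R S : Type u} [CommRing R] [CommRing S] (f : R →+* S) (c : R) (v : Fin 3 → R) :
      f ∘ (c • v) = f c • (f ∘ v) := by
    ext j
    simp
  by_cases hρ : ρ = 0
  · subst hρ
    refine ⟨M, s • secondPoint (C κ) (C 0) M ![1, 0, 0] B, ?_, ?_⟩
    · rw [conic_smul_right, conic_secondPoint, mul_zero]
      rw [C_0, conic_zero_right]
    · intro K _ _ _ x z hx hz h hgood hdisc
      have := charZero_of_injective_algebraMap (algebraMap k K).injective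
      rw [map_zero] at h hdisc
      obtain ⟨m, b, t, h1, h2⟩ := exists_eq_coords_of_zero hx hz (by simpa using h) hgood hdisc
      have h100 (f : MvPolynomial Params.{u} k →+* K) : f ∘ ![1, 0, 0] = ![1, 0, 0] := by
        ext j
        fin_cases j <;> simp
      refine ⟨paramValues m b t, fun i => ?_, ?_⟩
      · rw [← h1]
        refine (map_coords (aeval (paramValues m b t) :
          MvPolynomial Params.{u} k →ₐ[k] K).toRingHom _ _ i).trans ?_
        rw [hsmul, comp_secondPoint, hM, hB, hs, hC, hC, h100, map_zero]
      · rw [← h2]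
        refine (map_weightTwo (aeval (paramValues m b t) :
          MvPolynomial Params.{u} k →ₐ[k] K).toRingHom _ _).trans ?_
        rw [hsmul, comp_secondPoint, hM, hB, hs, hC, hC, h100, map_zero]
  · let W := tropeInv (C ω) (quadricPoint (C κ) (C ρ) M)
    refine ⟨tropeFst W, s • secondPoint (C κ) (C ρ) (tropeFst W) (tropeSnd W) B, ?_, ?_⟩
    · rw [conic_smul_right, conic_secondPoint, mul_zero]
      exact conic_quadricPoint (C_omega hω) _ _ _
    · intro K _ _ _ x z hx hz h hgood hdisc
      have := charZero_of_injective_algebraMap (algebraMap k K).injective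
      have hω' : algebraMap k K ω ^ 2 + algebraMap k K ω + 1 = 0 := by
        rw [← map_pow, ← map_add, ← map_one (algebraMap k _), ← map_add, hω, map_zero]
      have hκρ' : 2 * algebraMap k K ρ - algebraMap k K κ ≠ 0 := by
        rw [← map_ofNat (algebraMap k K), ← map_mul, ← map_sub]
        exact (map_ne_zero _).mpr (hκρ hρ)
      obtain ⟨m, b, t, h1, h2⟩ := exists_eq_coords_of_quadricPoint hω'
        ((map_ne_zero (algebraMap k K)).mpr hρ) hκρ' hx hz h hgood hdisc
      refine ⟨paramValues m b t, fun i => ?_, ?_⟩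
      · rw [← h1]
        refine (map_coords (aeval (paramValues m b t) :
          MvPolynomial Params.{u} k →ₐ[k] K).toRingHom _ _ i).trans ?_
        rw [hsmul, comp_secondPoint, comp_tropeFst, comp_tropeSnd, comp_tropeInv,
          comp_quadricPoint, hM, hB, hs, hC, hC, hC]
      · rw [← h2]
        refine (map_weightTwo (aeval (paramValues m b t) :
          MvPolynomial Params.{u} k →ₐ[k] K).toRingHom _ _).trans ?_
        rw [hsmul, comp_secondPoint, comp_tropeFst, comp_tropeSnd, comp_tropeInv,
          comp_quadricPoint, hM, hB, hs, hC, hC, hC]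

/-! ### Unirationality of the quartics and of the threefold -/

theorem aeval_psum_six {R : Type*} [CommRing R] [Algebra k R] (x : Fin 6 → R) (d : ℕ) :
    aeval x (psum (Fin 6) k d) = ∑ i, x i ^ d := by
  simp [psum]

/-- A point `x` with `x₀ = s ∑ xᵢ²` of the Coble fourfold lies on the quartic `X_t` with
`t = 1 / 4 + s²`. -/
theorem quarticIdeal_le_ker [CharZero k] {R : Type*} [CommRing R] [Algebra k R] {s : k}
    {x : Fin 6 → R} {z : R} (h1 : ∑ i, x i = 0)
    (hz : 4 * z ^ 2 = 4 * ∑ i, x i ^ 4 - (∑ i, x i ^ 2) ^ 2)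
    (h : z = algebraMap k R s * ∑ i, x i ^ 2) :
    (quarticIdeal (1 / 4 + s ^ 2)).toIdeal ≤ RingHom.ker (aeval x : MvPolynomial _ k →ₐ[k] R) := by
  refine Ideal.span_le.mpr ?_
  rintro _ (rfl | rfl)
  · exact (aeval_psum_six x 1).trans (by simpa using h1)
  · change aeval x _ = 0
    have h4 : 4 * algebraMap k R (1 / 4) = 1 := by
      rw [← map_ofNat (algebraMap k R), ← map_mul]
      norm_num
    rw [map_sub, map_mul, map_pow, aeval_psum_six, aeval_psum_six, aeval_C, map_add, map_pow]
    subst h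
    linear_combination -algebraMap k R (1 / 4) * hz + (algebraMap k R s ^ 2 * (∑ i, x i ^ 2) ^ 2
      - ∑ i, x i ^ 4) * h4

/-- The coordinates of a point of the Coble fourfold satisfy the equations of the threefold if
`∑ xᵢ² = 0`. -/
theorem threefoldInftyIdeal_le_ker [CharZero k] {R : Type*} [CommRing R] [Algebra k R]
    {x : Fin 6 → R} {z : R} (h1 : ∑ i, x i = 0)
    (hz : 4 * z ^ 2 = 4 * ∑ i, x i ^ 4 - (∑ i, x i ^ 2) ^ 2) (h : ∑ i, x i ^ 2 = 0) :
    (threefoldInftyIdeal k).toIdeal ≤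
      RingHom.ker (aeval (Fin.cons z x : Fin 7 → R) : MvPolynomial _ k →ₐ[k] R) := by
  have hp (d : ℕ) : aeval (Fin.cons z x : Fin 7 → R) (coblePsum k d) = ∑ i, x i ^ d := by
    simp [coblePsum]
  refine Ideal.span_le.mpr ?_
  rintro _ (rfl | rfl | rfl)
  · exact (hp 1).trans (by simpa using h1)
  · change aeval _ _ = 0
    have h4 : 4 * algebraMap k R (1 / 4) = 1 := by
      rw [← map_ofNat (algebraMap k R), ← map_mul]
      norm_num
    rw [map_sub, map_sub, map_mul, map_pow, map_pow, hp, hp, h, aeval_X, Fin.cons_zero]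
    rw [h] at hz
    linear_combination algebraMap k R (1 / 4) * hz - (z ^ 2 - ∑ i, x i ^ 4) * h4
  · exact (hp 2).trans h

theorem isUnirational_threefoldInfty [IsAlgClosed k] [CharZero k] :
    IsUnirational (threefoldInftyToSpec k) := by
  obtain ⟨ω, hω⟩ := exists_omega (k := k)
  obtain ⟨K, _, _, _, ι, hι⟩ := exists_ker_eq (k := k) (threefoldInftyIdeal k).toIdeal
  obtain ⟨a, b, hab, hgen⟩ := exists_parametrization hω (κ := (0 : k)) (ρ := 1)
    (fun _ => by norm_num)
  let e : MvPolynomial (Fin 7) k →ₐ[k] k := aeval (Fin.cons 0 (basePoint ω) : Fin 7 → k)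
  have he : (threefoldInftyIdeal k).toIdeal ≤ RingHom.ker e :=
    threefoldInftyIdeal_le_ker (sum_basePoint ω)
      (by rw [sum_basePoint_sq hω, sum_basePoint_pow_four hω]; ring) (sum_basePoint_sq hω)
  have hιe : RingHom.ker ι.toRingHom ≤ RingHom.ker e.toRingHom := hι.trans_le he
  have hex : e.toRingHom ∘ (fun i : Fin 6 => X i.succ) = basePoint ω := by
    ext i
    simp [e]
  have hez : e.toRingHom (X 0) = 0 := by simp [e]
  have hC (c : k) : ι.toRingHom (C c) = algebraMap k K c := ι.commutes c
  have heC (c : k) : e.toRingHom (C c) = c := e.commutes c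
  have hsq : ∑ i, coords a b i ^ 2 = 0 := by
    have := weightTwo_add_sum_sq (C (0 : k)) (C 1) a b
    rw [hab] at this
    simpa using this
  have hp (d : ℕ) : ι (coblePsum k d) = ∑ i : Fin 6, ι (X i.succ) ^ d := by simp [coblePsum]
  have hmem {g : MvPolynomial (Fin 7) k} (hg : g ∈ (threefoldInftyIdeal k).toIdeal) : ι g = 0 := by
    rwa [← hι] at hg
  have h2 : ∑ i : Fin 6, ι (X i.succ) ^ 2 = 0 := (hp 2).symm.trans (hmem coblePsum_mem_two)
  obtain ⟨y, hyx, hyz⟩ := hgen K (fun i => ι (X i.succ)) (ι (X 0))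
    (by simpa [hp] using hmem coblePsum_mem_one)
    (by
      have := hmem X_zero_sq_sub_mem
      rw [map_sub, map_sub, map_mul, map_pow, map_pow, hp, hp, h2] at this
      rw [h2]
      linear_combination 4 * this)
    (by rw [h2]; simp)
    (by
      rw [← hC]
      refine goodLocus_ne_zero_of_ker_le (x := fun i : Fin 6 => X i.succ) (z := X 0) hιe ?_
      rw [hex, hez, heC]
      exact goodLocus_basePoint hω)
    (by
      rw [← hC, ← hC]
      refine conicDisc_ne_zero_of_ker_le (x := fun i : Fin 6 => X i.succ) (z := X 0) hιe ?_
      rw [hex, hez, heC, heC, conicDisc_basePoint hω]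
      norm_num)
  refine isUnirational_of_ker_eq (n := Params.{u}) _ (threefoldInftyIdeal k)
    (aeval (Fin.cons (weightTwo a b) (coords a b) : Fin 7 → MvPolynomial Params.{u} k))
    (ker_eq_of_comp_eq (threefoldInftyIdeal_le_ker (sum_coords a b) (four_mul_weightTwo_sq a b) hsq)
      hι y ?_) one_pos (f := X 1) (isWeightedHomogeneous_X k cobleWeight 1) fun h => ?_
  · ext i
    cases i using Fin.cases with
    | zero => simpa using hyz
    | succ i => simpa using hyx i
  · have : e (X 1) = 0 := he h
    have h1 : e (X (Fin.succ 0)) = basePoint ω 0 := by simp [e]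
    rw [show (1 : Fin 7) = Fin.succ 0 from rfl, h1] at this
    simp [basePoint] at this

section Quartic

variable [CharZero k] {s : k} {K : Type u} [Field K] [Algebra k K]
variable {ι : MvPolynomial (Fin 6) k →ₐ[k] K}
variable (hι : RingHom.ker ι = (quarticIdeal (1 / 4 + s ^ 2)).toIdeal)

include hι

/-- Specialization of the generic point of a quartic to a point `p`. -/
theorem ker_le_ker_aeval {p : Fin 6 → k} (h1 : ∑ i, p i = 0)
    (hz : 4 * (s * ∑ i, p i ^ 2) ^ 2 = 4 * ∑ i, p i ^ 4 - (∑ i, p i ^ 2) ^ 2) :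
    RingHom.ker ι.toRingHom ≤
      RingHom.ker (aeval p : MvPolynomial (Fin 6) k →ₐ[k] k).toRingHom :=
  hι.trans_le (quarticIdeal_le_ker h1 hz rfl)

theorem ker_le_ker_aeval_basePoint {ω : k} (hω : ω ^ 2 + ω + 1 = 0) :
    RingHom.ker ι.toRingHom ≤
      RingHom.ker (aeval (basePoint ω) : MvPolynomial (Fin 6) k →ₐ[k] k).toRingHom :=
  ker_le_ker_aeval hι (sum_basePoint ω)
    (by rw [sum_basePoint_sq hω, sum_basePoint_pow_four hω]; ring)

omit hι [CharZero k] in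
theorem aeval_C_mul_psum_two (p : Fin 6 → k) :
    (aeval p : MvPolynomial (Fin 6) k →ₐ[k] k).toRingHom (C s * psum (Fin 6) k 2) =
      s * ∑ i, p i ^ 2 := by
  change aeval p _ = _
  rw [map_mul, aeval_psum_six, aeval_C]
  rfl

omit hι [CharZero k] in
theorem aeval_comp_X (p : Fin 6 → k) :
    (aeval p : MvPolynomial (Fin 6) k →ₐ[k] k).toRingHom ∘ X = p := by
  ext i
  simp

omit hι [CharZero k] in
theorem aeval_toRingHom_C (p : Fin 6 → k) (c : k) :
    (aeval p : MvPolynomial (Fin 6) k →ₐ[k] k).toRingHom (C c) = c :=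
  (aeval p : MvPolynomial (Fin 6) k →ₐ[k] k).commutes c

theorem goodLocus_generic_ne_zero {ω : k} (hω : ω ^ 2 + ω + 1 = 0) :
    goodLocus (ι.toRingHom (C ω)) (ι.toRingHom ∘ X) (ι.toRingHom (C s * psum (Fin 6) k 2)) ≠ 0 := by
  refine goodLocus_ne_zero_of_ker_le (ker_le_ker_aeval_basePoint hι hω) ?_
  rw [aeval_comp_X, aeval_C_mul_psum_two, aeval_toRingHom_C, sum_basePoint_sq hω, mul_zero]
  exact goodLocus_basePoint hω

/-- The generic conic is nondegenerate. The conic over the base point is nondegenerate unless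
`s = 0` or `s = ± 1 / 2`, and other special points are used for `s = 0` and `s = 1 / 2`. -/
theorem conicDisc_generic_ne_zero {ω : k} (hω : ω ^ 2 + ω + 1 = 0) (hs : s ≠ -(1 / 2)) :
    conicDisc (ι.toRingHom (C 1)) (ι.toRingHom (C (-s)))
      (fstPoint (ι.toRingHom ∘ X) (ι.toRingHom (C s * psum (Fin 6) k 2))) ≠ 0 := by
  by_cases h0 : s = 0
  · have hq : ∑ i, (![3, -5, -2, 3, 3, -2] : Fin 6 → k) i ^ 2 = 60 := by
      simp [Fin.sum_univ_succ]
      norm_num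
    refine conicDisc_ne_zero_of_ker_le
      (ker_le_ker_aeval hι (p := ![3, -5, -2, 3, 3, -2]) ?_ ?_) ?_
    · simp [Fin.sum_univ_succ]
      norm_num
    · rw [hq, h0]
      simp [Fin.sum_univ_succ]
      norm_num
    · rw [aeval_comp_X, aeval_C_mul_psum_two, aeval_toRingHom_C, aeval_toRingHom_C, h0, zero_mul,
        neg_zero]
      exact conicDisc_one_zero_ne_zero
  by_cases h2 : s = 1 / 2
  · have hq : ∑ i, (![0, -2, 1, 0, 0, 1] : Fin 6 → k) i ^ 2 = 6 := by
      simp [Fin.sum_univ_succ]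
      norm_num
    refine conicDisc_ne_zero_of_ker_le
      (ker_le_ker_aeval hι (p := ![0, -2, 1, 0, 0, 1]) ?_ ?_) ?_
    · simp [Fin.sum_univ_succ]
      norm_num
    · rw [hq, h2]
      simp [Fin.sum_univ_succ]
      norm_num
    · rw [aeval_comp_X, aeval_C_mul_psum_two, aeval_toRingHom_C, aeval_toRingHom_C, h2, hq,
        show (1 / 2 * 6 : k) = 3 by norm_num]
      exact conicDisc_one_neg_half_ne_zero
  refine conicDisc_ne_zero_of_ker_le (ker_le_ker_aeval_basePoint hι hω) ?_
  rw [aeval_comp_X, aeval_C_mul_psum_two, aeval_toRingHom_C, aeval_toRingHom_C,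
    sum_basePoint_sq hω, mul_zero, conicDisc_basePoint hω]
  have h3 : 2 * -s - 1 ≠ 0 := fun h => hs (by linear_combination -(1 / 2 : k) * h)
  have h4 : 1 + 2 * -s ≠ 0 := fun h => h2 (by linear_combination -(1 / 2 : k) * h)
  exact mul_ne_zero (by norm_num) (mul_ne_zero (mul_ne_zero (neg_ne_zero.mpr h0) h3) h4)

end Quartic

/-- The quartic `X_t` is unirational if `t = 1 / 4 + s²`, where `s ≠ -1 / 2`. -/
theorem isUnirational_quarticThreefold_add_sq [IsAlgClosed k] [CharZero k] {s : k}
    (hs : s ≠ -(1 / 2)) : IsUnirational (quarticThreefoldToSpec (1 / 4 + s ^ 2)) := by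
  obtain ⟨ω, hω⟩ := exists_omega (k := k)
  obtain ⟨K, _, _, _, ι, hι⟩ := exists_ker_eq (k := k) (quarticIdeal (1 / 4 + s ^ 2)).toIdeal
  obtain ⟨a, b, hab, hgen⟩ := exists_parametrization hω (κ := (1 : k)) (ρ := -s)
    (fun _ h => hs (by linear_combination -(1 / 2 : k) * h))
  have hC (c : k) : ι.toRingHom (C c) = algebraMap k K c := ι.commutes c
  have hp (d : ℕ) : ι (psum (Fin 6) k d) = ∑ i, ι (X i) ^ d := by simp [psum]
  have hιz : ι (C s * psum (Fin 6) k 2) = algebraMap k K s * ∑ i, ι (X i) ^ 2 := by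
    rw [map_mul, hp]
    congr 1
    exact hC s
  have hmem {g : MvPolynomial (Fin 6) k} (hg : g ∈ (quarticIdeal (1 / 4 + s ^ 2)).toIdeal) :
      ι g = 0 := by
    rwa [← hι] at hg
  have hsum : ∑ i, ι (X i) = 0 := by simpa using hmem (sum_X_mem_quarticIdeal _)
  have hquartic : 4 * (ι (C s * psum (Fin 6) k 2)) ^ 2 =
      4 * ∑ i, ι (X i) ^ 4 - (∑ i, ι (X i) ^ 2) ^ 2 := by
    have h := hmem (g := psum (Fin 6) k 4 - C (1 / 4 + s ^ 2) * psum (Fin 6) k 2 ^ 2)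
      (Ideal.subset_span (by simp))
    have hc : ι (C (1 / 4 + s ^ 2)) = algebraMap k K (1 / 4) + algebraMap k K s ^ 2 := by
      refine (hC _).trans ?_
      rw [map_add, map_pow]
    have h4 : 4 * algebraMap k K (1 / 4) = 1 := by
      rw [← map_ofNat (algebraMap k K), ← map_mul]
      norm_num
    rw [map_sub, map_mul, map_pow, hp, hp, hc] at h
    rw [hιz]
    linear_combination -4 * h - (∑ i, ι (X i) ^ 2) ^ 2 * h4
  have hgood := goodLocus_generic_ne_zero hι hω
  have hdisc := conicDisc_generic_ne_zero hι hω hs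
  rw [hC] at hgood
  rw [hC, hC] at hdisc
  obtain ⟨y, hyx, -⟩ := hgen K (fun i => ι (X i)) (ι (C s * psum (Fin 6) k 2)) hsum hquartic
    (by
      rw [hιz, map_one, map_neg]
      ring)
    hgood hdisc
  have hw : weightTwo a b = C s * ∑ i, coords a b i ^ 2 := by
    have := weightTwo_add_sum_sq (C (1 : k)) (C (-s)) a b
    rw [hab, C_1, C_neg] at this
    linear_combination this
  have hle : (quarticIdeal (1 / 4 + s ^ 2)).toIdeal ≤ RingHom.ker (aeval (coords a b) :
      MvPolynomial (Fin 6) k →ₐ[k] MvPolynomial Params.{u} k) :=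
    quarticIdeal_le_ker (sum_coords a b) (four_mul_weightTwo_sq a b) hw
  have hcomp : (aeval y).comp (aeval (coords a b) :
      MvPolynomial (Fin 6) k →ₐ[k] MvPolynomial Params.{u} k) = ι := by
    ext i
    simpa using hyx i
  have hX : (X 0 : MvPolynomial (Fin 6) k) ∉ (quarticIdeal (1 / 4 + s ^ 2)).toIdeal := fun h => by
    have : aeval (basePoint ω) (X 0 : MvPolynomial (Fin 6) k) = 0 :=
      ker_le_ker_aeval_basePoint hι hω (hι.ge h)
    simp [basePoint] at this
  have hX1 : (X 0 : MvPolynomial (Fin 6) k) ∈ homogeneousSubmodule (Fin 6) k 1 :=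
    isHomogeneous_X k 0
  exact isUnirational_of_ker_eq (homogeneousSubmodule (Fin 6) k) (quarticIdeal (1 / 4 + s ^ 2)) _
    (ker_eq_of_comp_eq hle hι y hcomp) one_pos hX1 hX

theorem isUnirational_quarticThreefold [IsAlgClosed k] [CharZero k] (t : k) :
    IsUnirational (quarticThreefoldToSpec t) := by
  -- Of the two square roots of `t - 1 / 4`, at least one differs from `-1 / 2`.
  obtain ⟨s, hs, rfl⟩ : ∃ s : k, s ≠ -(1 / 2) ∧ t = 1 / 4 + s ^ 2 := by
    obtain ⟨s, hs⟩ := IsAlgClosed.exists_pow_nat_eq (t - 1 / 4) two_pos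
    by_cases h : s = -(1 / 2)
    · refine ⟨1 / 2, by norm_num, ?_⟩
      rw [h] at hs
      linear_combination -hs
    · exact ⟨s, h, by linear_combination -hs⟩
  exact isUnirational_quarticThreefold_add_sq hs

end CobleFourfold

end

theorem corollary4p2 {k : Type u} [Field k] [IsAlgClosed k] [CharZero k] :
    (∀ t : k, IsUnirational (quarticThreefoldToSpec t)) ∧
      IsUnirational (threefoldInftyToSpec k) :=
  ⟨CobleFourfold.isUnirational_quarticThreefold, CobleFourfold.isUnirational_threefoldInfty⟩
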